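/- Let $\mathcal{M}'$ be a compact (smooth, boundaryless) Riemannian manifold, let $(G_i)_{i\in I}$ be a finite covering of $\mathcal{M}'$ by open sets and let $1\le p<\infty$. Then there is a constant $C\in[0,\infty)$, depending only on $(G_i)_{i\in I}$ (as a covering of the Riemannian manifold $\mathcal{M}'$) and on $p$, such that for every $\nu\in\mathbb{N}$, every Borel-measurable $F\colon\mathbb{R}^\nu\to[0,\infty]$ and every Borel-measurable $u\colon\mathcal{M}'\to\mathbb{R}^\nu$, $$\mathfrak{E}^{1,p}_F\bigl(u,\mathcal{M}',\mathcal{M}'\times[0,1)\bigr)\le C\sum_{i\in I}\mathfrak{E}^{1,p}_F\bigl(u|_{G_i},G_i,G_i\times[0,1)\bigr).$$ Here, for an open set $G\subseteq\mathcal{M}'$, $$\mathfrak{E}^{1,p}_F\bigl(u,G,G\times[0,1)\bigr)=\inf\Bigl\{\int_{G\times(0,1)}|\mathrm{D}U|^p+F(U)\ :\ U\in\dot W^{1,p}(G\times[0,1),\mathbb{R}^\nu),\ \operatorname{tr}_{G\times\{0\}}U=u\Bigr\}\in[0,\infty]$$ (with $\inf\emptyset=\infty$), where $G\times[0,1)$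 carries the product Riemannian metric and its volume measure, $|\cdot|$ is the induced (Hilbert–Schmidt) norm, $\dot W^{1,p}(G\times[0,1),\mathbb{R}^\nu)$ is the set of maps $U$ that are weakly differentiable (in local charts) on $G\times(0,1)$ with $\int_{G\times(0,1)}|\mathrm{D}U|^p<\infty$, and $\operatorname{tr}_{G\times\{0\}}U=u$ means that $\lim_{\varepsilon\to0}\frac1\varepsilon\int_0^\varepsilon\int_K|U(x,t)-u(x)|\,\mathrm{d}x\,\mathrm{d}t=0$ for every compact $K\subseteq G$. -/

import Mathlib

open MeasureTheory Set Filter Bundle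
open scoped Topology ENNReal NNReal ContDiff Manifold

noncomputable section

namespace PenalisedExtension

/-- `f' : X → (X →L[ℝ] W)` is the weak derivative of `f : X → W` on the open set `Ω ⊆ X`: both maps
are locally integrable on `Ω`, and for every smooth test function `ψ` with compact support in `Ω`
and every direction `v` one has `∫ (∂ᵥψ) f = - ∫ ψ (f' v)`. -/
def IsWeakFDerivOn {X W : Type*} [NormedAddCommGroup X] [NormedSpace ℝ X] [MeasureSpace X]
    [NormedAddCommGroup W] [NormedSpace ℝ W] (Ω : Set X) (f : X → W) (f' : X → X →L[ℝ] W) : Prop :=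
  LocallyIntegrableOn f Ω ∧ LocallyIntegrableOn f' Ω ∧
    ∀ ψ : X → ℝ, ContDiff ℝ ∞ ψ → HasCompactSupport ψ → tsupport ψ ⊆ Ω →
      ∀ v : X, ∫ x in Ω, fderiv ℝ ψ x v • f x = - ∫ x in Ω, ψ x • f' x v

section Manifold

variable {d : ℕ} {M : Type*} [TopologicalSpace M] [ChartedSpace (EuclideanSpace ℝ (Fin d)) M]

/-- The differential at `y` of the inverse of the chart `chartAt x₀`, as a linear map from `ℝᵈ` to
the tangent space of `M` at the point with coordinates `y`. -/
def chartSymmDeriv (x₀ : M) (y : EuclideanSpace ℝ (Fin d)) :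
    EuclideanSpace ℝ (Fin d) →L[ℝ]
      TangentSpace (𝓡 d) ((chartAt (EuclideanSpace ℝ (Fin d)) x₀).symm y) :=
  mfderiv (𝓡 d) (𝓡 d) (chartAt (EuclideanSpace ℝ (Fin d)) x₀).symm y

/-- The part of the collar `G × (0,1)` in the domain of the chart at `x₀`, in coordinates. -/
def chartCollar (x₀ : M) (G : Set M) : Set (EuclideanSpace ℝ (Fin d) × ℝ) :=
  ((chartAt (EuclideanSpace ℝ (Fin d)) x₀).target ∩
    (chartAt (EuclideanSpace ℝ (Fin d)) x₀).symm ⁻¹' G) ×ˢ Ioo (0 : ℝ) 1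

/-- `DU` is the weak derivative of `U` on `G × (0,1)`, through local charts: here `DU (x, t)` is a
linear map on the tangent space `TₓM × ℝ` of `M × ℝ`, and in each chart
`(y, t) ↦ (φ⁻¹ y, t)` the pulled back `DU` is the weak derivative of the pulled back `U`. -/
def IsWeakDerivOnCollar {ν : ℕ} (G : Set M) (U : M × ℝ → EuclideanSpace ℝ (Fin ν))
    (DU : ∀ z : M × ℝ, TangentSpace (𝓡 d) z.1 × ℝ →L[ℝ] EuclideanSpace ℝ (Fin ν)) : Prop :=
  ∀ x₀ : M, IsWeakFDerivOn (chartCollar x₀ G)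
    (fun z => U ((chartAt (EuclideanSpace ℝ (Fin d)) x₀).symm z.1, z.2))
    (fun z => (DU ((chartAt (EuclideanSpace ℝ (Fin d)) x₀).symm z.1, z.2)).comp
      ((chartSymmDeriv x₀ z.1).prodMap (ContinuousLinearMap.id ℝ ℝ)))

variable [RiemannianBundle (fun x : M => TangentSpace (𝓡 d) x)]

/-- The Riemannian volume density `√(det (gᵢⱼ))` in the chart at `x₀`, where
`gᵢⱼ = ⟨∂ᵢ, ∂ⱼ⟩` for the coordinate vector fields `∂ᵢ` of that chart. -/
def chartDensity (x₀ : M) (y : EuclideanSpace ℝ (Fin d)) : ℝ :=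
  √ (Matrix.of fun i j : Fin d =>
      inner ℝ (chartSymmDeriv x₀ y (EuclideanSpace.single i 1))
        (chartSymmDeriv x₀ y (EuclideanSpace.single j 1))).det

/-- The Riemannian volume measure restricted to the domain of the chart at `x₀`. -/
def chartVolume [MeasurableSpace M] (x₀ : M) : Measure M :=
  (((volume : Measure (EuclideanSpace ℝ (Fin d))).restrict
    (chartAt (EuclideanSpace ℝ (Fin d)) x₀).target).withDensity
      (fun y => ENNReal.ofReal (chartDensity x₀ y))).map
    (chartAt (EuclideanSpace ℝ (Fin d)) x₀).symm

variable (d M) in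
/-- The Riemannian volume measure of `M`: the measures `chartVolume x₀` agree on the overlaps of the
chart domains, and their least upper bound is the measure that restricts to each of them. -/
def riemannianVolume [MeasurableSpace M] : Measure M := ⨆ x₀ : M, chartVolume (d := d) x₀

variable (d M) in
/-- The Riemannian volume measure of the product manifold `M × ℝ`. -/
def collarVolume [MeasurableSpace M] : Measure (M × ℝ) := (riemannianVolume d M).prod volume

/-- The (Hilbert–Schmidt) norm of a linear map on `TₓM × ℝ`, for the product Riemannian metric:
the square root of the sum of the `‖A e‖²`, `e` running over an orthonormal basis of `TₓM × ℝ`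
adapted to the product. -/
def derivNorm {ν : ℕ} (x : M)
    (A : TangentSpace (𝓡 d) x × ℝ →L[ℝ] EuclideanSpace ℝ (Fin ν)) : ℝ :=
  haveI : FiniteDimensional ℝ (TangentSpace (𝓡 d) x) :=
    inferInstanceAs (FiniteDimensional ℝ (EuclideanSpace ℝ (Fin d)))
  √ ((∑ i, ‖A (stdOrthonormalBasis ℝ (TangentSpace (𝓡 d) x) i, 0)‖ ^ 2) + ‖A (0, 1)‖ ^ 2)

variable (d) in
/-- `u` is the trace of `U` on `G × {0}`: `U (·, t) → u` in `L¹_loc(G)` as `t → 0`, the limit being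
averaged over `t ∈ (0, ε)` since `U` is only defined almost everywhere. For `U` continuous on
`G × [0,1)` this is the restriction of `U` to `G × {0}`. -/
def HasTrace [MeasurableSpace M] {ν : ℕ} (G : Set M) (U : M × ℝ → EuclideanSpace ℝ (Fin ν))
    (u : M → EuclideanSpace ℝ (Fin ν)) : Prop :=
  ∀ K ⊆ G, IsCompact K →
    Tendsto (fun ε : ℝ => (ENNReal.ofReal ε)⁻¹ *
      ∫⁻ z in K ×ˢ Ioo 0 ε, ‖U z - u z.1‖ₑ ∂(collarVolume d M)) (𝓝[>] 0) (𝓝 0)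

/-- The penalised extension energy of `u` on the collar `G × [0,1)` of the open set `G ⊆ M`:
the infimum of `∫_{G × (0,1)} |DU|ᵖ + F(U)` over the weakly differentiable maps
`U : G × [0,1) → ℝ^ν` with `∫ |DU|ᵖ < ∞` and with trace `u` on `G × {0}`. -/
def extEnergy (d : ℕ) {M : Type*} [TopologicalSpace M] [ChartedSpace (EuclideanSpace ℝ (Fin d)) M]
    [RiemannianBundle (fun x : M => TangentSpace (𝓡 d) x)] [MeasurableSpace M]
    {ν : ℕ} (p : ℝ) (F : EuclideanSpace ℝ (Fin ν) → ℝ≥0∞) (u : M → EuclideanSpace ℝ (Fin ν))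
    (G : Set M) : ℝ≥0∞ :=
  ⨅ (U : M × ℝ → EuclideanSpace ℝ (Fin ν))
    (DU : ∀ z : M × ℝ, TangentSpace (𝓡 d) z.1 × ℝ →L[ℝ] EuclideanSpace ℝ (Fin ν))
    (_ : IsWeakDerivOnCollar G U DU)
    (_ : ∫⁻ z in G ×ˢ Ioo 0 1, ENNReal.ofReal (derivNorm z.1 (DU z) ^ p) ∂(collarVolume d M) ≠ ⊤)
    (_ : HasTrace d G U u),
    ∫⁻ z in G ×ˢ Ioo 0 1,
      (ENNReal.ofReal (derivNorm z.1 (DU z) ^ p) + F (U z)) ∂(collarVolume d M)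

end Manifold

end PenalisedExtension

end

/-!
A smooth partition of unity `ρ₀, …, ρ_{N-1}` subordinate to the covering cuts each vertical segment
`{x} × (0, 1)` into intervals of lengths `ρ_k x`: the `k`-th cell is the part of `M × (0, 1)`
between the graphs of `∑_{i<k} ρ_i` and `∑_{i≤k} ρ_i`, and lies over `G_k`. Given competitors `U_k`
on the collars of the `G_k`, all with trace `u`, let `U (x, t) = U_k (x, τ)` on the `k`-th cell,
where `τ` is the distance from `t` to the nearer end of the interval. This map takes the value `u`
on both boundaries of each cell, so its traces from the two sides of an interface agree, and its
trace at `t = 0` is `u`.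

Each half of a cell is the image of the layer `{0 < τ < ρ_k x / 2}` under a shear
`(x, τ) ↦ (x, s x ± τ)`, which preserves every product measure `μ × dt` (`lintegral_halfCell`). The
values of `U_k` are transported without averaging, so `∫ F(U)` is at most `2 ∑_k ∫ F(U_k)` for every
`F`, and `|DU|` is at most a constant times `|DU_k|`, the constant depending on a bound for `dρ_k`
only (`derivNorm_comp_cellMap_le`, `lintegral_glue_le`).

The weak differentiability of `U` is local and is checked in charts (`isWeakFDerivOn_glue`). It rests
on Green's formula on a layer (`green_layer`). Test fields on a cell are folded onto the layer by
adding up their two pull-backs; the sum is tangent to the upper boundary of the layer, since the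
fold is a reflection there, and only the integrals over `{τ = 0}` against `u` are left
(`sum_integral_halfCell`). These cancel between neighbouring cells (`sum_boundaryFlux_eq_zero`).
Where `ρ_k` vanishes, so does `dρ_k`, and the empty cell makes no contribution. Green's formula is
proved with cutoffs of width `ε`: near `{τ = 0}` the averaged `L¹` form of the trace is exactly what
the limit needs, and near the upper boundary tangency compensates the factor `1 / ε`, so that no
trace is needed there.
-/

noncomputable section

set_option linter.unusedSectionVars false

namespace PenalisedExtension

/-! ### Vertical shears -/

section Shear

variable {X : Type*} [MeasurableSpace X]

/-- The vertical change of variables `(x, t) ↦ (x, s x + c t)` of `X × ℝ`, where `c = ±1`. -/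
def shear (s : X → ℝ) (hs : Measurable s) (c : ℝ) (hc : c * c = 1) : X × ℝ ≃ᵐ X × ℝ where
  toFun z := (z.1, s z.1 + c * z.2)
  invFun z := (z.1, c * (z.2 - s z.1))
  left_inv z := by
    ext <;> simp [← mul_assoc, hc]
  right_inv z := by
    ext <;> simp [← mul_assoc, hc]
  measurable_toFun := by
    simp only [Equiv.coe_fn_mk]; fun_prop
  measurable_invFun := by
    simp only [Equiv.coe_fn_symm_mk]; fun_prop

/-- No finiteness of `μ` is needed: the product with an s-finite measure on the right is computed
by slicing. -/
lemma measurePreserving_shear (μ : Measure X) (s : X → ℝ) (hs : Measurable s) (c : ℝ)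
    (hc : c * c = 1) :
    MeasurePreserving (shear s hs c hc) (μ.prod (volume : Measure ℝ)) (μ.prod volume) := by
  refine ⟨(shear s hs c hc).measurable, ?_⟩
  have hline : ∀ r : ℝ, MeasurePreserving (fun t : ℝ => r + c * t) volume volume := by
    intro r
    rcases mul_self_eq_one_iff.1 hc with rfl | rfl
    · simpa using measurePreserving_add_left volume r
    · simpa [Function.comp_def] using (measurePreserving_add_left volume r).comp
        (Measure.measurePreserving_neg (volume : Measure ℝ))
  ext A hA
  rw [Measure.map_apply (shear s hs c hc).measurable hA, Measure.prod_apply hA,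
    Measure.prod_apply ((shear s hs c hc).measurable hA)]
  refine lintegral_congr fun x => ?_
  exact (hline (s x)).measure_preimage (measurable_prodMk_left hA).nullMeasurableSet

/-- The graph of a measurable function is a null set of the product. -/
lemma measure_graph_eq_zero (μ : Measure X) {s : X → ℝ} (hs : Measurable s) :
    (μ.prod (volume : Measure ℝ)) {z | z.2 = s z.1} = 0 := by
  have hm : MeasurableSet {z : X × ℝ | z.2 = s z.1} :=
    measurableSet_eq_fun measurable_snd (hs.comp measurable_fst)
  rw [Measure.prod_apply hm]
  refine (lintegral_congr fun x => ?_).trans lintegral_zero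
  have : Prod.mk x ⁻¹' {z : X × ℝ | z.2 = s z.1} = {s x} := by ext t; simp
  rw [this]; simp

end Shear

/-! ### The cells and the glued map -/

section Cells

variable {X : Type*}

/-- The partial sums `ρ₀ + ⋯ + ρ_{k-1}` and, for `b = true`, `ρ₀ + ⋯ + ρ_k`: the lower and upper
boundary of the `k`-th cell. -/
def base (ρ : ℕ → X → ℝ) (k : ℕ) (b : Bool) (x : X) : ℝ :=
  ∑ i ∈ Finset.range (k + b.toNat), ρ i x

/-- The orientation of a half cell: upwards from the lower boundary, downwards from the upper
one. -/
def orient (b : Bool) : ℝ := if b then -1 else 1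

lemma orient_mul_self (b : Bool) : orient b * orient b = 1 := by cases b <;> simp [orient]

/-- The distance to the boundary from which a half cell is measured. -/
def depth (ρ : ℕ → X → ℝ) (k : ℕ) (b : Bool) (z : X × ℝ) : ℝ :=
  orient b * (z.2 - base ρ k b z.1)

/-- The points `(x, τ)` with `0 < τ < r x / 2`. -/
def layer (r : X → ℝ) : Set (X × ℝ) := {z | 0 < z.2 ∧ z.2 < r z.1 / 2}

/-- The half cells: the set between the graphs of `∑_{i<k} ρᵢ` and `∑_{i≤k} ρᵢ`, cut along the
middle. The lower half has `b = false`, the upper half `b = true`. -/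
def halfCell (ρ : ℕ → X → ℝ) (k : ℕ) (b : Bool) : Set (X × ℝ) :=
  {z | 0 < depth ρ k b z ∧ depth ρ k b z < ρ k z.1 / 2}

/-- The map which on the `k`-th cell is `U k` at the vertical distance to the boundary of the
cell. It is `0` outside the half cells, in particular on the middle of each cell, a null set. -/
def glue {W : Type*} [AddCommMonoid W] (N : ℕ) (ρ : ℕ → X → ℝ) (U : ℕ → X × ℝ → W) (z : X × ℝ) :
    W :=
  ∑ k ∈ Finset.range N, ∑ b : Bool,
    (halfCell ρ k b).indicator (fun z => U k (z.1, depth ρ k b z)) z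

lemma base_true (ρ : ℕ → X → ℝ) (k : ℕ) (x : X) :
    base ρ k true x = base ρ k false x + ρ k x := by
  simp [base, Finset.sum_range_succ]

lemma base_succ_false (ρ : ℕ → X → ℝ) (k : ℕ) (x : X) :
    base ρ (k + 1) false x = base ρ k true x := by
  simp [base]

lemma base_zero (ρ : ℕ → X → ℝ) (x : X) : base ρ 0 false x = 0 := by simp [base]

lemma base_nonneg {ρ : ℕ → X → ℝ} {x : X} (h0 : ∀ k, 0 ≤ ρ k x) (k : ℕ) (b : Bool) :
    0 ≤ base ρ k b x := Finset.sum_nonneg fun i _ => h0 i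

lemma base_false_mono {ρ : ℕ → X → ℝ} {x : X} (h0 : ∀ k, 0 ≤ ρ k x) {k l : ℕ} (hkl : k ≤ l) :
    base ρ k false x ≤ base ρ l false x :=
  Finset.sum_le_sum_of_subset_of_nonneg (Finset.range_mono (by simpa using hkl))
    fun i _ _ => h0 i

/-- The half cells are pairwise disjoint. -/
lemma eq_of_mem_halfCell {ρ : ℕ → X → ℝ} {z : X × ℝ} (h0 : ∀ k, 0 ≤ ρ k z.1) {k l : ℕ}
    {b b' : Bool} (hk : z ∈ halfCell ρ k b) (hl : z ∈ halfCell ρ l b') : k = l ∧ b = b' := by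
  have key : ∀ {k : ℕ} {b : Bool}, z ∈ halfCell ρ k b →
      base ρ k false z.1 < z.2 ∧ z.2 < base ρ (k + 1) false z.1 := by
    intro k b h
    have := base_true ρ k z.1
    rw [base_succ_false]
    cases b <;> simp only [halfCell, depth, orient, mem_ofPred_eq] at h <;>
      constructor <;> simp at h <;> linarith [h0 k, h.1, h.2]
  have h1 := key hk
  have h2 := key hl
  have hkl : k = l := by
    by_contra hne
    rcases lt_or_gt_of_ne hne with h | h
    · linarith [base_false_mono h0 (show k + 1 ≤ l from h)]
    · linarith [base_false_mono h0 (show l + 1 ≤ k from h)]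
  subst hkl
  refine ⟨rfl, ?_⟩
  have := base_true ρ k z.1
  cases b <;> cases b' <;> simp [halfCell, depth, orient] at hk hl ⊢ <;> linarith [hk.2, hl.2]

lemma sum_eq_of_mem_halfCell {W : Type*} [AddCommMonoid W] {N : ℕ} {ρ : ℕ → X → ℝ} {z : X × ℝ}
    (h0 : ∀ k, 0 ≤ ρ k z.1) {k : ℕ} (hk : k < N) {b : Bool} (hz : z ∈ halfCell ρ k b)
    (f : ℕ → Bool → W) (hf : ∀ l b', z ∉ halfCell ρ l b' → f l b' = 0) :
    ∑ l ∈ Finset.range N, ∑ b' : Bool, f l b' = f k b := by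
  rw [Finset.sum_eq_single k, Finset.sum_eq_single b]
  · intro b' _ hb'
    exact hf _ _ fun h => hb' (eq_of_mem_halfCell h0 h hz).2
  · simp
  · intro l _ hl
    exact Finset.sum_eq_zero fun b' _ => hf _ _ fun h => hl (eq_of_mem_halfCell h0 h hz).1
  · simp [hk]

lemma glue_eq_of_mem {W : Type*} [AddCommMonoid W] {N : ℕ} {ρ : ℕ → X → ℝ} {U : ℕ → X × ℝ → W}
    {z : X × ℝ} (h0 : ∀ k, 0 ≤ ρ k z.1) {k : ℕ} (hk : k < N) {b : Bool}
    (hz : z ∈ halfCell ρ k b) : glue N ρ U z = U k (z.1, depth ρ k b z) := by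
  rw [glue, sum_eq_of_mem_halfCell h0 hk hz
    (fun k b => (halfCell ρ k b).indicator (fun z => U k (z.1, depth ρ k b z)) z)
    (fun l b' h => indicator_of_notMem h _), indicator_of_mem hz]

/-- Away from the graphs of the cell boundaries and of their middles, the half cells cover
`X × (0, 1)`. -/
lemma exists_mem_halfCell {N : ℕ} {ρ : ℕ → X → ℝ} {z : X × ℝ}
    (h1 : ∑ i ∈ Finset.range N, ρ i z.1 = 1) (hz : z.2 ∈ Ioo (0 : ℝ) 1)
    (hb : ∀ k b, z.2 ≠ base ρ k b z.1) (hm : ∀ k, z.2 ≠ base ρ k false z.1 + ρ k z.1 / 2) :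
    ∃ k < N, ∃ b, z ∈ halfCell ρ k b := by
  classical
  have hex : ∃ n, z.2 < base ρ n false z.1 := ⟨N, by simpa [base, h1] using hz.2⟩
  have hn := Nat.find_spec hex
  have hN : Nat.find hex ≤ N := Nat.find_min' hex (by simpa [base, h1] using hz.2)
  obtain ⟨k, hk⟩ : ∃ k, Nat.find hex = k + 1 := by
    refine Nat.exists_eq_succ_of_ne_zero fun h => ?_
    rw [h, base_zero] at hn
    exact absurd hn (not_lt.2 hz.1.le)
  have hlt : ¬ z.2 < base ρ k false z.1 := Nat.find_min hex (by omega)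
  have hlow : base ρ k false z.1 < z.2 := lt_of_le_of_ne (not_lt.1 hlt) (hb k false).symm
  rw [hk, base_succ_false] at hn
  have ht := base_true ρ k z.1
  refine ⟨k, by omega, ?_⟩
  rcases lt_or_gt_of_ne (hm k) with h | h
  · refine ⟨false, ?_⟩
    simp only [halfCell, depth, orient, mem_ofPred_eq]
    constructor <;> simp <;> linarith
  · refine ⟨true, ?_⟩
    simp only [halfCell, depth, orient, mem_ofPred_eq]
    constructor <;> simp <;> linarith

/-- Because of this bound, the glued map near `t = 0` only involves the `U k` near `t = 0`, also on
the cells which do not touch `{t = 0}` everywhere. -/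
lemma depth_le_of_mem_halfCell {ρ : ℕ → X → ℝ} {z : X × ℝ} (h0 : ∀ k, 0 ≤ ρ k z.1) {k : ℕ}
    {b : Bool} (hz : z ∈ halfCell ρ k b) : depth ρ k b z ≤ z.2 := by
  have h := base_nonneg h0 k false
  have := base_true ρ k z.1
  cases b <;> simp [halfCell, depth, orient] at hz ⊢ <;> linarith [hz.1, hz.2]

lemma depth_cellShear {ρ : ℕ → X → ℝ} (k : ℕ) (b : Bool) (x : X) (t : ℝ) :
    depth ρ k b (x, base ρ k b x + orient b * t) = t := by
  simp [depth, ← mul_assoc, orient_mul_self]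

variable [MeasurableSpace X]

lemma measurable_base {ρ : ℕ → X → ℝ} (hρ : ∀ k, Measurable (ρ k)) (k : ℕ) (b : Bool) :
    Measurable (base ρ k b) := by
  unfold base; fun_prop

lemma measurable_depth {ρ : ℕ → X → ℝ} (hρ : ∀ k, Measurable (ρ k)) (k : ℕ) (b : Bool) :
    Measurable (depth ρ k b) := by
  have := measurable_base hρ k b
  unfold depth; fun_prop

lemma measurableSet_halfCell {ρ : ℕ → X → ℝ} (hρ : ∀ k, Measurable (ρ k)) (k : ℕ) (b : Bool) :
    MeasurableSet (halfCell ρ k b) := by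
  have h := measurable_depth hρ k b
  have h' : Measurable fun z : X × ℝ => ρ k z.1 / 2 := ((hρ k).comp measurable_fst).div_const 2
  exact (measurableSet_lt measurable_const h).inter (measurableSet_lt h h')

lemma measurableSet_layer {r : X → ℝ} (hr : Measurable r) : MeasurableSet (layer r) := by
  have h' : Measurable fun z : X × ℝ => r z.1 / 2 := (hr.comp measurable_fst).div_const 2
  exact (measurableSet_lt measurable_const measurable_snd).inter
    (measurableSet_lt measurable_snd h')

/-- The shear which maps the layer `{0 < τ < ρ_k / 2}` to a half cell. -/
abbrev cellShear {ρ : ℕ → X → ℝ} (hρ : ∀ k, Measurable (ρ k)) (k : ℕ) (b : Bool) :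
    X × ℝ ≃ᵐ X × ℝ :=
  shear (base ρ k b) (measurable_base hρ k b) (orient b) (orient_mul_self b)

lemma cellShear_apply {ρ : ℕ → X → ℝ} (hρ : ∀ k, Measurable (ρ k)) (k : ℕ) (b : Bool)
    (z : X × ℝ) : cellShear hρ k b z = (z.1, base ρ k b z.1 + orient b * z.2) := rfl

lemma cellShear_symm_preimage_layer {ρ : ℕ → X → ℝ} (hρ : ∀ k, Measurable (ρ k)) (k : ℕ)
    (b : Bool) : (cellShear hρ k b).symm ⁻¹' layer (ρ k) = halfCell ρ k b := rfl

lemma cellShear_preimage_halfCell {ρ : ℕ → X → ℝ} (hρ : ∀ k, Measurable (ρ k)) (k : ℕ)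
    (b : Bool) : cellShear hρ k b ⁻¹' halfCell ρ k b = layer (ρ k) := by
  rw [← cellShear_symm_preimage_layer hρ, ← preimage_comp]
  simp

lemma measurePreserving_cellShear (μ : Measure X) {ρ : ℕ → X → ℝ} (hρ : ∀ k, Measurable (ρ k))
    (k : ℕ) (b : Bool) :
    MeasurePreserving (cellShear hρ k b) (μ.prod (volume : Measure ℝ)) (μ.prod volume) :=
  measurePreserving_shear _ _ _ _ _

/-- A lower Lebesgue integral over the half cells, of an arbitrary function of `(x, τ)`, is the
integral over the layer. -/
lemma lintegral_halfCell (μ : Measure X) {ρ : ℕ → X → ℝ} (hρ : ∀ k, Measurable (ρ k)) (k : ℕ)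
    (b : Bool) (f : X × ℝ → ℝ≥0∞) :
    ∫⁻ z in halfCell ρ k b, f (z.1, depth ρ k b z) ∂(μ.prod volume) =
      ∫⁻ z in layer (ρ k), f z ∂(μ.prod volume) :=
  ((measurePreserving_cellShear μ hρ k b).symm _).setLIntegral_comp_preimage_emb
    (cellShear hρ k b).symm.measurableEmbedding f (layer (ρ k))

/-- Up to a null set, `X × (0, 1)` is covered by the half cells. -/
lemma ae_mem_halfCell (μ : Measure X) {N : ℕ} {ρ : ℕ → X → ℝ} (hρ : ∀ k, Measurable (ρ k))
    (h1 : ∀ x, ∑ i ∈ Finset.range N, ρ i x = 1) :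
    ∀ᵐ z ∂(μ.prod (volume : Measure ℝ)), z.2 ∈ Ioo (0 : ℝ) 1 →
      ∃ k < N, ∃ b, z ∈ halfCell ρ k b := by
  have hb : ∀ᵐ z ∂(μ.prod (volume : Measure ℝ)), ∀ k b, z.2 ≠ base ρ k b z.1 := by
    refine ae_all_iff.2 fun k => ae_all_iff.2 fun b => ?_
    simpa [ae_iff] using measure_graph_eq_zero μ (measurable_base hρ k b)
  have hm : ∀ᵐ z ∂(μ.prod (volume : Measure ℝ)), ∀ k,
      z.2 ≠ base ρ k false z.1 + ρ k z.1 / 2 := by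
    refine ae_all_iff.2 fun k => ?_
    simpa [ae_iff] using measure_graph_eq_zero μ
      ((measurable_base hρ k false).add ((hρ k).div_const 2))
  filter_upwards [hb, hm] with z hb hm hz
  exact exists_mem_halfCell (h1 z.1) hz hb hm

lemma lintegral_le_sum_halfCell (μ : Measure X) {N : ℕ} {ρ : ℕ → X → ℝ}
    (hρ : ∀ k, Measurable (ρ k)) (h1 : ∀ x, ∑ i ∈ Finset.range N, ρ i x = 1)
    (f : X × ℝ → ℝ≥0∞) {A : Set (X × ℝ)} (hA : ∀ z ∈ A, z.2 ∈ Ioo (0 : ℝ) 1) :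
    ∫⁻ z in A, f z ∂(μ.prod volume) ≤
      ∑ k ∈ Finset.range N, ∑ b : Bool,
        ∫⁻ z in halfCell ρ k b ∩ A, f z ∂(μ.prod volume) := by
  calc ∫⁻ z in A, f z ∂(μ.prod volume)
      ≤ ∫⁻ z in ⋃ j : Fin N × Bool, halfCell ρ j.1 j.2 ∩ A, f z ∂(μ.prod volume) := by
        refine lintegral_mono' (Measure.restrict_mono_ae ?_) le_rfl
        filter_upwards [ae_mem_halfCell μ hρ h1] with z hz hzA
        obtain ⟨k, hk, b, h⟩ := hz (hA z hzA)
        exact mem_iUnion.2 ⟨(⟨k, hk⟩, b), h, hzA⟩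
    _ ≤ _ := (lintegral_iUnion_le _ _).trans_eq (by
        rw [tsum_fintype, Fintype.sum_prod_type, Finset.sum_range])

end Cells

/-! ### A smooth step function -/

section SmoothStep

/-- A smooth monotone step, equal to `0` on `(-∞, 1]` and to `1` on `[2, ∞)`. -/
def smoothStep (x : ℝ) : ℝ := Real.smoothTransition (x - 1)

lemma smoothStep_of_le_one {x : ℝ} (h : x ≤ 1) : smoothStep x = 0 :=
  Real.smoothTransition.zero_of_nonpos (by linarith)

lemma smoothStep_of_two_le {x : ℝ} (h : 2 ≤ x) : smoothStep x = 1 :=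
  Real.smoothTransition.one_of_one_le (by linarith)

lemma contDiff_smoothStep : ContDiff ℝ ∞ smoothStep :=
  Real.smoothTransition.contDiff.comp (contDiff_id.sub contDiff_const)

lemma abs_smoothStep_le_one (x : ℝ) : |smoothStep x| ≤ 1 := by
  rw [smoothStep, abs_of_nonneg (Real.smoothTransition.nonneg _)]
  exact Real.smoothTransition.le_one _

lemma deriv_smoothStep_nonneg (x : ℝ) : 0 ≤ deriv smoothStep x :=
  Monotone.deriv_nonneg fun _ _ h => Real.smoothTransition.monotone (by linarith)

lemma deriv_smoothStep_of_lt {x : ℝ} (h : x < 1) : deriv smoothStep x = 0 := by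
  have : smoothStep =ᶠ[𝓝 x] fun _ => 0 := by
    filter_upwards [Iio_mem_nhds h] with y hy using smoothStep_of_le_one (le_of_lt hy)
  rw [this.deriv_eq]; simp

lemma deriv_smoothStep_of_gt {x : ℝ} (h : 2 < x) : deriv smoothStep x = 0 := by
  have : smoothStep =ᶠ[𝓝 x] fun _ => 1 := by
    filter_upwards [Ioi_mem_nhds h] with y hy using smoothStep_of_two_le (le_of_lt hy)
  rw [this.deriv_eq]; simp

lemma continuous_deriv_smoothStep : Continuous (deriv smoothStep) :=
  contDiff_smoothStep.continuous_deriv (by simp)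

lemma hasDerivAt_smoothStep (x : ℝ) : HasDerivAt smoothStep (deriv smoothStep x) x :=
  (contDiff_smoothStep.differentiable (by simp) x).hasDerivAt

lemma exists_deriv_smoothStep_le : ∃ C, 0 ≤ C ∧ ∀ x, |deriv smoothStep x| ≤ C := by
  obtain ⟨C, hC⟩ := isCompact_Icc.exists_bound_of_continuousOn (s := Icc (1 : ℝ) 2)
    continuous_deriv_smoothStep.continuousOn
  refine ⟨C, (norm_nonneg _).trans (hC 1 (by simp)), fun x => ?_⟩
  rcases lt_or_ge x 1 with h | h
  · simpa [deriv_smoothStep_of_lt h] using (norm_nonneg _).trans (hC 1 (by simp))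
  rcases lt_or_ge 2 x with h' | h'
  · simpa [deriv_smoothStep_of_gt h'] using (norm_nonneg _).trans (hC 1 (by simp))
  · exact hC x ⟨h, h'⟩

/-- The rescaled derivative `ε⁻¹ η'(τ / ε)` is an approximation of the unit mass at `0`. -/
lemma integral_deriv_smoothStep {ε : ℝ} (hε : 0 < ε) (hε4 : 4 * ε ≤ 1) :
    ∫ t in Ioo (0 : ℝ) (1 / 2), deriv smoothStep (t / ε) / ε = 1 := by
  have hd : ∀ t : ℝ, HasDerivAt (fun t => smoothStep (t / ε)) (deriv smoothStep (t / ε) / ε) t := by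
    intro t
    simpa [div_eq_mul_inv, Function.comp_def] using
      (hasDerivAt_smoothStep (t / ε)).comp t ((hasDerivAt_id t).div_const ε)
  have hc : Continuous fun t : ℝ => deriv smoothStep (t / ε) / ε :=
    (continuous_deriv_smoothStep.comp (continuous_id.div_const ε)).div_const ε
  rw [← integral_Ioc_eq_integral_Ioo,
    ← intervalIntegral.integral_of_le (by norm_num : (0 : ℝ) ≤ 1 / 2),
    intervalIntegral.integral_eq_sub_of_hasDerivAt (fun t _ => hd t) (hc.intervalIntegrable _ _),
    smoothStep_of_two_le (by rw [le_div_iff₀ hε]; linarith), smoothStep_of_le_one (by simp),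
    sub_zero]

end SmoothStep

/-! ### Weak derivatives -/

section Weak

variable {X W : Type*} [NormedAddCommGroup X] [NormedSpace ℝ X] [MeasureSpace X]
  [NormedAddCommGroup W] [NormedSpace ℝ W]

/-- In the definition of the weak derivative the integrals can be restricted to any set which
contains the support of the test function. -/
lemma IsWeakFDerivOn.setIntegral_eq {O D : Set X} {f : X → W} {f' : X → X →L[ℝ] W}
    (h : IsWeakFDerivOn O f f') (hO : MeasurableSet O) (hD : D ⊆ O) {ψ : X → ℝ}
    (hψ : ContDiff ℝ ∞ ψ) (hc : HasCompactSupport ψ) (ht : tsupport ψ ⊆ D) (v : X) :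
    ∫ x in D, fderiv ℝ ψ x v • f x = - ∫ x in D, ψ x • f' x v := by
  rw [← setIntegral_eq_of_subset_of_forall_sdiff_eq_zero hO hD,
    ← setIntegral_eq_of_subset_of_forall_sdiff_eq_zero hO hD]
  · exact h.2.2 ψ hψ hc (ht.trans hD) v
  · rintro x ⟨-, hx⟩
    rw [image_eq_zero_of_notMem_tsupport fun h => hx (ht h), zero_smul]
  · rintro x ⟨-, hx⟩
    rw [show fderiv ℝ ψ x = 0 from
      Function.notMem_support.1 fun h => hx (ht (support_fderiv_subset ℝ h))]
    simp

lemma integrableOn_continuous_smul_of_subset [OpensMeasurableSpace X] [SecondCountableTopology X]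
    {D K : Set X} {f : X → W} (hf : IntegrableOn f D) (hD : MeasurableSet D) (hK : IsCompact K)
    (hDK : D ⊆ K) {g : X → ℝ} (hg : Continuous g) : IntegrableOn (fun x => g x • f x) D := by
  obtain ⟨C, hC⟩ := hK.exists_bound_of_continuousOn hg.continuousOn
  refine hf.bdd_smul C hg.aestronglyMeasurable ?_
  filter_upwards [ae_restrict_mem hD] with x hx using hC x (hDK hx)

end Weak

/-! ### Green's formula on a layer -/

section Green

variable {E V : Type*} [NormedAddCommGroup E] [NormedSpace ℝ E] [MeasureSpace E] [BorelSpace E]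
  [SecondCountableTopology E] [SFinite (volume : Measure E)]
  [NormedAddCommGroup V] [NormedSpace ℝ V]

/-- The cutoff which vanishes near the boundary `{τ = 0} ∪ {τ = r / 2}` of the layer and is `1` at
distance `2 ε` from it. -/
def layerCutoff (r : E → ℝ) (ε : ℝ) (z : E × ℝ) : ℝ :=
  smoothStep (z.2 / ε) * smoothStep ((r z.1 / 2 - z.2) / ε)

lemma contDiff_layerCutoff {r : E → ℝ} (hr : ContDiff ℝ ∞ r) (ε : ℝ) :
    ContDiff ℝ ∞ (layerCutoff r ε) := by
  unfold layerCutoff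
  have h1 : ContDiff ℝ ∞ fun z : E × ℝ => z.2 / ε := contDiff_snd.div_const ε
  have h2 : ContDiff ℝ ∞ fun z : E × ℝ => (r z.1 / 2 - z.2) / ε :=
    (((hr.comp contDiff_fst).div_const 2).sub contDiff_snd).div_const ε
  exact (contDiff_smoothStep.comp h1).mul (contDiff_smoothStep.comp h2)

lemma fderiv_layerCutoff_mul {r : E → ℝ} (hr : ContDiff ℝ ∞ r) {a : E × ℝ → ℝ}
    (ha : ContDiff ℝ ∞ a) (ε : ℝ) (z w : E × ℝ) :
    fderiv ℝ (fun z => layerCutoff r ε z * a z) z w =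
      layerCutoff r ε z * fderiv ℝ a z w +
        a z * (smoothStep (z.2 / ε) *
            (deriv smoothStep ((r z.1 / 2 - z.2) / ε) / ε * (fderiv ℝ r z.1 w.1 / 2 - w.2)) +
          deriv smoothStep (z.2 / ε) / ε * smoothStep ((r z.1 / 2 - z.2) / ε) * w.2) := by
  have hr' : HasFDerivAt (fun z : E × ℝ => r z.1)
      ((fderiv ℝ r z.1).comp (ContinuousLinearMap.fst ℝ E ℝ)) z :=
    ((hr.differentiable (by simp) z.1).hasFDerivAt).comp z hasFDerivAt_fst
  have ha' : HasFDerivAt a (fderiv ℝ a z) z := (ha.differentiable (by simp) z).hasFDerivAt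
  have h1 : HasFDerivAt (fun z : E × ℝ => z.2 / ε) (ε⁻¹ • ContinuousLinearMap.snd ℝ E ℝ) z := by
    refine ((hasFDerivAt_snd (𝕜 := ℝ) (E := E) (F := ℝ) (p := z)).const_smul
      ε⁻¹).congr_of_eventuallyEq (Eventually.of_forall fun y => ?_)
    simp [div_eq_inv_mul]
  have h2 : HasFDerivAt (fun z : E × ℝ => (r z.1 / 2 - z.2) / ε)
      (ε⁻¹ • ((2 : ℝ)⁻¹ • (fderiv ℝ r z.1).comp (ContinuousLinearMap.fst ℝ E ℝ) -
        ContinuousLinearMap.snd ℝ E ℝ)) z := by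
    have := ((hr'.const_smul (2 : ℝ)⁻¹).sub
      (hasFDerivAt_snd (𝕜 := ℝ) (E := E) (F := ℝ) (p := z))).const_smul ε⁻¹
    refine this.congr_of_eventuallyEq (Eventually.of_forall fun y => ?_)
    simp; ring
  have h3 := (hasDerivAt_smoothStep (z.2 / ε)).comp_hasFDerivAt z h1
  have h4 := (hasDerivAt_smoothStep ((r z.1 / 2 - z.2) / ε)).comp_hasFDerivAt z h2
  have h5 := (h3.mul h4).mul ha'
  have h6 : (fun z => layerCutoff r ε z * a z) = ((smoothStep ∘ fun z : E × ℝ => z.2 / ε) *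
      (smoothStep ∘ fun z : E × ℝ => (r z.1 / 2 - z.2) / ε)) * a := rfl
  rw [h6, h5.fderiv]
  simp [layerCutoff]
  ring

lemma layerCutoff_of_notMem {r : E → ℝ} {ε : ℝ} (hε : 0 < ε) {z : E × ℝ}
    (hz : ¬ (ε ≤ z.2 ∧ z.2 ≤ r z.1 / 2 - ε)) : layerCutoff r ε z = 0 := by
  unfold layerCutoff
  rcases not_and_or.1 hz with h | h
  · rw [smoothStep_of_le_one, zero_mul]
    rw [div_le_one hε]; linarith
  · rw [smoothStep_of_le_one (x := (r z.1 / 2 - z.2) / ε), mul_zero]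
    rw [div_le_one hε]; linarith

lemma abs_layerCutoff_le (r : E → ℝ) (ε : ℝ) (z : E × ℝ) : |layerCutoff r ε z| ≤ 1 := by
  rw [layerCutoff, abs_mul]
  exact mul_le_one₀ (abs_smoothStep_le_one _) (abs_nonneg _) (abs_smoothStep_le_one _)

lemma tendsto_div_nhdsGT_zero {x : ℝ} (hx : 0 < x) :
    Tendsto (fun ε : ℝ => x / ε) (𝓝[>] 0) atTop := by
  simpa [div_eq_mul_inv] using tendsto_inv_nhdsGT_zero.const_mul_atTop hx

lemma tendsto_layerCutoff (r : E → ℝ) (z : E × ℝ) :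
    Tendsto (fun ε => layerCutoff r ε z) (𝓝[>] 0) (𝓝 ((layer r).indicator 1 z)) := by
  by_cases hz : z ∈ layer r
  · rw [indicator_of_mem hz]
    have h1 := (tendsto_div_nhdsGT_zero hz.1).eventually_ge_atTop 2
    have h2 := (tendsto_div_nhdsGT_zero (sub_pos.2 hz.2)).eventually_ge_atTop 2
    refine tendsto_const_nhds.congr' ?_
    filter_upwards [h1, h2] with ε h1 h2
    simp [layerCutoff, smoothStep_of_two_le h1, smoothStep_of_two_le h2]
  · rw [indicator_of_notMem hz]
    refine tendsto_const_nhds.congr' ?_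
    filter_upwards [self_mem_nhdsWithin] with ε (hε : 0 < ε)
    refine (layerCutoff_of_notMem hε fun h => hz ⟨by linarith [h.1], by linarith [h.2]⟩).symm

/-- The part of the cutoff error that lives near the upper boundary of the layer tends to `0`
because the function `g`, the normal component of the field, vanishes there. -/
lemma tendsto_integral_upper {D : Set (E × ℝ)} {W : E × ℝ → V} {r : E → ℝ} {g : E × ℝ → ℝ}
    (hD : MeasurableSet D) (hW : IntegrableOn W D) (hr : Continuous r) (hg : Continuous g)
    {L : ℝ} (hgL : ∀ z ∈ D, |g z| ≤ L * |r z.1 / 2 - z.2|) (hL : 0 ≤ L) :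
    Tendsto (fun ε => ∫ z in D, (smoothStep (z.2 / ε) *
      (deriv smoothStep ((r z.1 / 2 - z.2) / ε) / ε) * g z) • W z) (𝓝[>] 0) (𝓝 0) := by
  obtain ⟨C, hC0, hC⟩ := exists_deriv_smoothStep_le
  have hcs := contDiff_smoothStep.continuous
  have hcd := continuous_deriv_smoothStep
  rw [← integral_zero (E × ℝ) V (μ := volume.restrict D)]
  refine tendsto_integral_filter_of_dominated_convergence (fun z => (2 * C * L) * ‖W z‖) ?_ ?_
    (hW.norm.const_mul _) ?_
  · refine Eventually.of_forall fun ε => ?_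
    refine AEStronglyMeasurable.smul (Continuous.aestronglyMeasurable ?_) hW.1
    fun_prop
  · filter_upwards [self_mem_nhdsWithin] with ε (hε : 0 < ε)
    filter_upwards [ae_restrict_mem hD] with z hz
    rw [norm_smul]
    gcongr
    rw [Real.norm_eq_abs, abs_mul, abs_mul, abs_div, abs_of_pos hε]
    set x := (r z.1 / 2 - z.2) / ε with hx
    have hxe : |r z.1 / 2 - z.2| = ε * |x| := by
      rw [hx, abs_div, abs_of_pos hε]; field_simp
    have key : |deriv smoothStep x| * |x| ≤ 2 * C := by
      by_cases h : 1 ≤ x ∧ x ≤ 2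
      · rw [abs_of_nonneg (by linarith : (0 : ℝ) ≤ x)]
        nlinarith [hC x, abs_nonneg (deriv smoothStep x)]
      · have : deriv smoothStep x = 0 := by
          rcases not_and_or.1 h with h | h
          · exact deriv_smoothStep_of_lt (not_le.1 h)
          · exact deriv_smoothStep_of_gt (not_le.1 h)
        rw [this]; simpa using hC0
    calc |smoothStep (z.2 / ε)| * (|deriv smoothStep x| / ε) * |g z|
        ≤ 1 * (|deriv smoothStep x| / ε) * (L * (ε * |x|)) := by
          gcongr
          · exact abs_smoothStep_le_one _
          · exact hxe ▸ hgL z hz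
      _ = (|deriv smoothStep x| * |x|) * L := by field_simp
      _ ≤ 2 * C * L := by gcongr
  · refine Eventually.of_forall fun z => ?_
    refine tendsto_const_nhds.congr' ?_
    have : ∀ᶠ ε : ℝ in 𝓝[>] 0, deriv smoothStep ((r z.1 / 2 - z.2) / ε) = 0 := by
      rcases lt_or_ge 0 (r z.1 / 2 - z.2) with h | h
      · filter_upwards [(tendsto_div_nhdsGT_zero h).eventually_gt_atTop 2] with ε h'
        exact deriv_smoothStep_of_gt h'
      · filter_upwards [self_mem_nhdsWithin] with ε (hε : 0 < ε)
        exact deriv_smoothStep_of_lt ((div_nonpos_of_nonpos_of_nonneg h hε.le).trans_lt one_pos)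
    filter_upwards [this] with ε hε
    simp [hε]

/-- Near the lower boundary of the layer, `W` may be replaced by its trace `u`. -/
lemma tendsto_integral_lower_sub {K : Set E} {W : E × ℝ → V} {u : E → V} {q : ℝ → E × ℝ → ℝ}
    (hK : MeasurableSet K)
    (htr : Tendsto (fun ε : ℝ => (ENNReal.ofReal ε)⁻¹ *
      ∫⁻ z in K ×ˢ Ioo 0 ε, ‖W z - u z.1‖ₑ) (𝓝[>] 0) (𝓝 0))
    {C : ℝ} (hC : 0 ≤ C) (hq : ∀ ε z, |q ε z| ≤ C) :
    Tendsto (fun ε => ∫ z in K ×ˢ Ioo (0 : ℝ) (1 / 2),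
      (deriv smoothStep (z.2 / ε) / ε * q ε z) • (W z - u z.1)) (𝓝[>] 0) (𝓝 0) := by
  obtain ⟨M, hM0, hM⟩ := exists_deriv_smoothStep_le
  have h3 : Tendsto (fun ε : ℝ => 3 * ε) (𝓝[>] 0) (𝓝[>] 0) := by
    refine tendsto_nhdsWithin_iff.2 ⟨?_, ?_⟩
    · refine Tendsto.mono_left ?_ nhdsWithin_le_nhds
      have : Continuous fun ε : ℝ => 3 * ε := by fun_prop
      simpa using this.tendsto 0
    · filter_upwards [self_mem_nhdsWithin] with ε (hε : 0 < ε)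
      exact mul_pos three_pos hε
  have hlim := ENNReal.Tendsto.const_mul (htr.comp h3)
    (Or.inr (ENNReal.ofReal_ne_top (r := M * C * 3)))
  rw [mul_zero] at hlim
  rw [tendsto_zero_iff_enorm_tendsto_zero]
  refine tendsto_of_tendsto_of_tendsto_of_le_of_le' tendsto_const_nhds hlim
    (Eventually.of_forall fun _ => zero_le) ?_
  filter_upwards [self_mem_nhdsWithin] with ε (hε : 0 < ε)
  have hD : MeasurableSet (K ×ˢ Ioo (0 : ℝ) (1 / 2)) := hK.prod measurableSet_Ioo
  have hD' : MeasurableSet (K ×ˢ Ioo (0 : ℝ) (3 * ε)) := hK.prod measurableSet_Ioo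
  calc ‖∫ z in K ×ˢ Ioo (0 : ℝ) (1 / 2), (deriv smoothStep (z.2 / ε) / ε * q ε z) •
          (W z - u z.1)‖ₑ
      ≤ ∫⁻ z in K ×ˢ Ioo (0 : ℝ) (1 / 2), ‖(deriv smoothStep (z.2 / ε) / ε * q ε z) •
          (W z - u z.1)‖ₑ := enorm_integral_le_lintegral_enorm _
    _ ≤ ∫⁻ z in K ×ˢ Ioo (0 : ℝ) (3 * ε), ENNReal.ofReal (M / ε * C) * ‖W z - u z.1‖ₑ := by
        rw [← lintegral_indicator hD, ← lintegral_indicator hD']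
        refine lintegral_mono fun z => ?_
        by_cases hz : z ∈ K ×ˢ Ioo (0 : ℝ) (1 / 2)
        · rw [indicator_of_mem hz]
          by_cases hz' : z.2 < 3 * ε
          · rw [indicator_of_mem (show z ∈ K ×ˢ Ioo (0 : ℝ) (3 * ε) from
              ⟨hz.1, hz.2.1, hz'⟩), enorm_smul]
            gcongr
            rw [← ofReal_norm, Real.norm_eq_abs, abs_mul, abs_div, abs_of_pos hε]
            apply ENNReal.ofReal_le_ofReal
            gcongr
            · exact hM _
            · exact hq _ _
          · have : deriv smoothStep (z.2 / ε) = 0 := by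
              refine deriv_smoothStep_of_gt ?_
              rw [lt_div_iff₀ hε]; linarith
            simp [this]
        · rw [indicator_of_notMem hz]; exact zero_le
    _ = ENNReal.ofReal (M * C * 3) * ((ENNReal.ofReal (3 * ε))⁻¹ *
          ∫⁻ z in K ×ˢ Ioo (0 : ℝ) (3 * ε), ‖W z - u z.1‖ₑ) := by
        rw [lintegral_const_mul' _ _ ENNReal.ofReal_ne_top, ← mul_assoc,
          ← ENNReal.ofReal_inv_of_pos (by positivity), ← ENNReal.ofReal_mul (by positivity)]
        congr 2
        field_simp

/-- The part of the cutoff error that lives near the lower boundary of the layer converges to a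
boundary integral. -/
lemma tendsto_integral_lower {K : Set E} {u : E → V} {r : E → ℝ} {b : E × ℝ → ℝ}
    [CompleteSpace V] (hK : IsCompact K) (hu : IntegrableOn u K) (hr : ContDiff ℝ ∞ r)
    (hb : ContDiff ℝ ∞ b) (hbc : HasCompactSupport b) :
    Tendsto (fun ε => ∫ z in K ×ˢ Ioo (0 : ℝ) (1 / 2),
      (deriv smoothStep (z.2 / ε) / ε * (smoothStep ((r z.1 / 2 - z.2) / ε) * b z)) • u z.1)
      (𝓝[>] 0) (𝓝 (∫ y in K ∩ {y | 0 < r y}, b (y, 0) • u y)) := by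
  obtain ⟨C, hC⟩ := hbc.exists_bound_of_continuous hb.continuous
  obtain ⟨L, hL⟩ := hb.lipschitzWith_of_hasCompactSupport hbc (by simp)
  have hC0 : 0 ≤ C := (norm_nonneg _).trans (hC 0)
  have hcs := contDiff_smoothStep.continuous
  have hcd := continuous_deriv_smoothStep
  have hrc := hr.continuous
  have hbc' := hb.continuous
  let q : ℝ → E × ℝ → ℝ := fun ε z => deriv smoothStep (z.2 / ε) / ε *
    (smoothStep ((r z.1 / 2 - z.2) / ε) * b z)
  have hqc : ∀ ε, Continuous (q ε) := fun ε => by fun_prop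
  let g : ℝ → E → ℝ := fun ε y => ∫ t in Ioo (0 : ℝ) (1 / 2), q ε (y, t)
  have hfub : ∀ ε, ∫ z in K ×ˢ Ioo (0 : ℝ) (1 / 2), q ε z • u z.1 = ∫ y in K, g ε y • u y := by
    intro ε
    have hint : IntegrableOn (fun z : E × ℝ => u z.1) (K ×ˢ Ioo (0 : ℝ) (1 / 2)) := by
      rw [IntegrableOn, Measure.volume_eq_prod, ← Measure.prod_restrict]
      exact hu.comp_fst _
    rw [Measure.volume_eq_prod, setIntegral_prod]
    · exact integral_congr_ae (Eventually.of_forall fun y =>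
        integral_smul_const (fun t => q ε (y, t)) (u y))
    · exact integrableOn_continuous_smul_of_subset hint (hK.measurableSet.prod measurableSet_Ioo)
        (hK.prod isCompact_Icc) (prod_mono_right Ioo_subset_Icc_self) (hqc ε)
  have hsmall : ∀ᶠ ε : ℝ in 𝓝[>] 0, 0 < ε ∧ 4 * ε ≤ 1 := by
    filter_upwards [Ioo_mem_nhdsGT (show (0 : ℝ) < 1 / 4 by norm_num)] with ε hε
    exact ⟨hε.1, by linarith [hε.2]⟩
  have hint1 : ∀ ε : ℝ, IntegrableOn (fun t : ℝ => deriv smoothStep (t / ε) / ε)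
      (Ioo (0 : ℝ) (1 / 2)) := fun ε =>
    (Continuous.integrableOn_Icc (by fun_prop)).mono_set Ioo_subset_Icc_self
  have hint2 : ∀ ε y, IntegrableOn (fun t : ℝ => q ε (y, t)) (Ioo (0 : ℝ) (1 / 2)) := fun ε y =>
    (Continuous.integrableOn_Icc (by fun_prop)).mono_set Ioo_subset_Icc_self
  -- since `ε⁻¹ η'(τ / ε)` has integral `1`, the values of `g ε` are averages
  have havg : ∀ ε : ℝ, 0 < ε → 4 * ε ≤ 1 → ∀ (h : ℝ → ℝ) (B : ℝ),
      (∀ t ∈ Ioo (0 : ℝ) (1 / 2), |deriv smoothStep (t / ε) / ε * h t| ≤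
        deriv smoothStep (t / ε) / ε * B) →
      |∫ t in Ioo (0 : ℝ) (1 / 2), deriv smoothStep (t / ε) / ε * h t| ≤ B := by
    intro ε hε hε4 h B hB
    calc |∫ t in Ioo (0 : ℝ) (1 / 2), deriv smoothStep (t / ε) / ε * h t|
        ≤ ∫ t in Ioo (0 : ℝ) (1 / 2), deriv smoothStep (t / ε) / ε * B :=
          norm_integral_le_of_norm_le (f := fun t => deriv smoothStep (t / ε) / ε * h t)
            ((hint1 ε).mul_const B)
            (by filter_upwards [ae_restrict_mem measurableSet_Ioo] with t ht using hB t ht)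
      _ = B := by rw [integral_mul_const, integral_deriv_smoothStep hε hε4, one_mul]
  have hD0 : ∀ ε : ℝ, 0 < ε → ∀ t, 0 ≤ deriv smoothStep (t / ε) / ε := fun ε hε t =>
    div_nonneg (deriv_smoothStep_nonneg _) hε.le
  have hlimit : ∫ y in K ∩ {y | 0 < r y}, b (y, 0) • u y =
      ∫ y in K, ({y | 0 < r y}.indicator (fun y => b (y, 0)) y) • u y := by
    rw [← setIntegral_indicator (measurableSet_lt measurable_const hrc.measurable)]
    refine integral_congr_ae (Eventually.of_forall fun y => ?_)
    by_cases hy : y ∈ {y | 0 < r y}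
    · simp only [indicator_of_mem hy]
    · simp only [indicator_of_notMem hy, zero_smul]
  rw [hlimit]
  simp only [show ∀ (ε : ℝ) (z : E × ℝ), deriv smoothStep (z.2 / ε) / ε *
    (smoothStep ((r z.1 / 2 - z.2) / ε) * b z) = q ε z from fun _ _ => rfl, hfub]
  refine tendsto_integral_filter_of_dominated_convergence (fun y => C * ‖u y‖) ?_ ?_
    (hu.norm.const_mul C) ?_
  · refine Eventually.of_forall fun ε => AEStronglyMeasurable.smul ?_ hu.1
    exact ((hqc ε).stronglyMeasurable.integral_prod_right'
      (ν := volume.restrict (Ioo (0 : ℝ) (1 / 2)))).aestronglyMeasurable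
  · filter_upwards [hsmall] with ε hε
    refine Eventually.of_forall fun y => ?_
    rw [norm_smul]
    gcongr
    refine havg ε hε.1 hε.2 _ C fun t _ => ?_
    rw [abs_mul, abs_of_nonneg (hD0 ε hε.1 t), abs_mul]
    gcongr
    · exact hD0 ε hε.1 t
    · calc _ ≤ 1 * C := by
            gcongr
            · exact abs_smoothStep_le_one _
            · exact hC _
        _ = C := one_mul C
  · refine Eventually.of_forall fun y => Tendsto.smul_const ?_ _
    by_cases hy : 0 < r y
    · rw [indicator_of_mem (show y ∈ {y | 0 < r y} from hy)]
      have h0 : Tendsto (fun ε : ℝ => L * (2 * ε)) (𝓝[>] 0) (𝓝 0) := by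
        refine Tendsto.mono_left ?_ nhdsWithin_le_nhds
        have : Continuous fun ε : ℝ => L * (2 * ε) := by fun_prop
        simpa using this.tendsto 0
      refine tendsto_iff_norm_sub_tendsto_zero.2 ?_
      refine tendsto_of_tendsto_of_tendsto_of_le_of_le' tendsto_const_nhds h0
        (Eventually.of_forall fun _ => norm_nonneg _) ?_
      have h8 := (tendsto_div_nhdsGT_zero hy).eventually_ge_atTop 8
      filter_upwards [hsmall, h8] with ε hε h8
      have heq : g ε y - b (y, 0) = ∫ t in Ioo (0 : ℝ) (1 / 2), deriv smoothStep (t / ε) / ε *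
          (smoothStep ((r y / 2 - t) / ε) * b (y, t) - b (y, 0)) := by
        simp only [mul_sub]
        rw [integral_sub (hint2 ε y) ((hint1 ε).mul_const _), integral_mul_const,
          integral_deriv_smoothStep hε.1 hε.2, one_mul]
      rw [heq]
      refine havg ε hε.1 hε.2 _ _ fun t ht => ?_
      rw [abs_mul, abs_of_nonneg (hD0 ε hε.1 t)]
      rcases lt_or_ge 2 (t / ε) with ht2 | ht2
      · simp [deriv_smoothStep_of_gt ht2]
      · have ht2' : t ≤ 2 * ε := (div_le_iff₀ hε.1).1 ht2
        have h8' : 8 * ε ≤ r y := (le_div_iff₀ hε.1).1 h8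
        have h1 : smoothStep ((r y / 2 - t) / ε) = 1 := by
          refine smoothStep_of_two_le ?_
          rw [le_div_iff₀ hε.1]; linarith
        have hd : dist (y, t) (y, (0 : ℝ)) = t := by
          rw [Prod.dist_eq]; simp [abs_of_pos ht.1, ht.1.le]
        have := hL.dist_le_mul (y, t) (y, 0)
        rw [hd, Real.dist_eq] at this
        rw [h1, one_mul]
        gcongr
        · exact hD0 ε hε.1 t
        · exact this.trans (by gcongr)
    · rw [indicator_of_notMem (show y ∉ {y | 0 < r y} from hy)]
      refine tendsto_const_nhds.congr' ?_
      filter_upwards [self_mem_nhdsWithin] with ε (hε : 0 < ε)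
      refine (setIntegral_eq_zero_of_forall_eq_zero fun t ht => ?_).symm
      have : smoothStep ((r y / 2 - t) / ε) = 0 := by
        refine smoothStep_of_le_one ?_
        rw [div_le_one hε]; linarith [ht.1]
      simp [q, this]

/-- **Green's formula on a layer.** Let `W` be weakly differentiable with trace `u` on `{τ = 0}`.
A smooth field `(a v, b)` tangent to the upper boundary `{τ = r / 2}` of the layer has no flux
through it, so only the lower boundary contributes. -/
theorem green_layer [CompleteSpace V] {Ω K : Set E} {W : E × ℝ → V} {W' : E × ℝ → E × ℝ →L[ℝ] V}
    {u : E → V} {r : E → ℝ} {a b : E × ℝ → ℝ} {v : E}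
    (hΩ : IsOpen Ω) (hW : IsWeakFDerivOn (Ω ×ˢ Ioo 0 1) W W') (hK : IsCompact K) (hKΩ : K ⊆ Ω)
    (hWi : IntegrableOn W (K ×ˢ Ioo 0 (1 / 2))) (hWi' : IntegrableOn W' (K ×ˢ Ioo 0 (1 / 2)))
    (hu : IntegrableOn u K)
    (htr : Tendsto (fun ε : ℝ => (ENNReal.ofReal ε)⁻¹ *
      ∫⁻ z in K ×ˢ Ioo 0 ε, ‖W z - u z.1‖ₑ) (𝓝[>] 0) (𝓝 0))
    (hr : ContDiff ℝ ∞ r) (hr1 : ∀ y ∈ K, r y ≤ 1)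
    (ha : ContDiff ℝ ∞ a) (hac : HasCompactSupport a)
    (hb : ContDiff ℝ ∞ b) (hbc : HasCompactSupport b)
    (hsupp : ∀ z, z.1 ∉ K → 0 < r z.1 → a z = 0 ∧ b z = 0)
    (htan : ∀ y, b (y, r y / 2) = a (y, r y / 2) * (fderiv ℝ r y v / 2)) :
    ∫ z in layer r ∩ K ×ˢ univ, ((fderiv ℝ a z (v, 0) + fderiv ℝ b z (0, 1)) • W z +
      (a z • W' z (v, 0) + b z • W' z (0, 1))) = - ∫ y in K ∩ {y | 0 < r y}, b (y, 0) • u y := by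
  set D : Set (E × ℝ) := K ×ˢ Ioo (0 : ℝ) (1 / 2) with hDdef
  have hDm : MeasurableSet D := hK.measurableSet.prod measurableSet_Ioo
  have hDc : IsCompact (K ×ˢ Icc (0 : ℝ) (1 / 2)) := hK.prod isCompact_Icc
  have hDs : D ⊆ K ×ˢ Icc (0 : ℝ) (1 / 2) := prod_mono_right Ioo_subset_Icc_self
  have hDO : D ⊆ Ω ×ˢ Ioo (0 : ℝ) 1 :=
    prod_mono hKΩ (Ioo_subset_Ioo_right (by norm_num))
  have hOm : MeasurableSet (Ω ×ˢ Ioo (0 : ℝ) 1) := hΩ.measurableSet.prod measurableSet_Ioo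
  have hcs := contDiff_smoothStep.continuous
  have hcd := continuous_deriv_smoothStep
  have hrc := hr.continuous
  have hac' := ha.continuous
  have hbc' := hb.continuous
  have hdr : Continuous fun z : E × ℝ => fderiv ℝ r z.1 v :=
    ((hr.continuous_fderiv (by simp)).comp continuous_fst).clm_apply continuous_const
  have hda : Continuous fun z => fderiv ℝ a z (v, 0) :=
    (ha.continuous_fderiv (by simp)).clm_apply continuous_const
  have hdb : Continuous fun z => fderiv ℝ b z (0, 1) :=
    (hb.continuous_fderiv (by simp)).clm_apply continuous_const
  have hW'v : ∀ w, IntegrableOn (fun z => W' z w) D := fun w =>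
    ((ContinuousLinearMap.apply ℝ V w).integrable_comp hWi')
  have hui : IntegrableOn (fun z : E × ℝ => u z.1) D := by
    rw [IntegrableOn, hDdef, Measure.volume_eq_prod, ← Measure.prod_restrict]
    exact hu.comp_fst _
  have hsm : ∀ {f : E × ℝ → V} {g : E × ℝ → ℝ}, IntegrableOn f D → Continuous g →
      IntegrableOn (fun z => g z • f z) D := fun hf hg =>
    integrableOn_continuous_smul_of_subset hf hDm hDc hDs hg
  -- the weak derivative tested with the truncated components of the field
  have hweak : ∀ ε : ℝ, 0 < ε → ∀ (c : E × ℝ → ℝ), ContDiff ℝ ∞ c →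
      (∀ z, z.1 ∉ K → 0 < r z.1 → c z = 0) → ∀ w,
      ∫ z in D, fderiv ℝ (fun z => layerCutoff r ε z * c z) z w • W z =
        - ∫ z in D, (layerCutoff r ε z * c z) • W' z w := by
    intro ε hε c hc hcs w
    have hsub : Function.support (fun z => layerCutoff r ε z * c z) ⊆
        (K ×ˢ univ) ∩ {z : E × ℝ | ε ≤ z.2 ∧ z.2 ≤ r z.1 / 2 - ε} := by
      intro z hz
      have hz1 : ε ≤ z.2 ∧ z.2 ≤ r z.1 / 2 - ε := by
        by_contra h
        exact hz (by simp [layerCutoff_of_notMem hε h])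
      refine ⟨⟨?_, mem_univ _⟩, hz1⟩
      by_contra h
      exact hz (by simp [hcs z h (by linarith [hz1.1, hz1.2])])
    have hcl : IsClosed ((K ×ˢ univ) ∩ {z : E × ℝ | ε ≤ z.2 ∧ z.2 ≤ r z.1 / 2 - ε}) := by
      refine (hK.isClosed.prod isClosed_univ).inter (IsClosed.inter ?_ ?_)
      · exact isClosed_le continuous_const continuous_snd
      · exact isClosed_le continuous_snd (by fun_prop)
    have hts := closure_minimal hsub hcl
    have htD : tsupport (fun z => layerCutoff r ε z * c z) ⊆ D := by
      intro z hz
      obtain ⟨⟨h1, -⟩, h2, h3⟩ := hts hz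
      exact ⟨h1, by linarith, by linarith [hr1 z.1 h1]⟩
    exact hW.setIntegral_eq hOm hDO ((contDiff_layerCutoff hr ε).mul hc)
      (hDc.of_isClosed_subset (isClosed_tsupport _) (htD.trans hDs)) htD w
  let g : E × ℝ → ℝ := fun z => a z * (fderiv ℝ r z.1 v / 2) - b z
  have hg : Continuous g := by fun_prop
  obtain ⟨L, hL, hgL⟩ : ∃ L : ℝ, 0 ≤ L ∧ ∀ z ∈ D, |g z| ≤ L * |r z.1 / 2 - z.2| := by
    obtain ⟨La, hLa⟩ := ha.lipschitzWith_of_hasCompactSupport hac (by simp)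
    obtain ⟨Lb, hLb⟩ := hb.lipschitzWith_of_hasCompactSupport hbc (by simp)
    obtain ⟨R, hR⟩ := hDc.exists_bound_of_continuousOn hdr.continuousOn
    refine ⟨La * (|R| / 2) + Lb, by positivity, fun z hz => ?_⟩
    have hd : dist z (z.1, r z.1 / 2) = |r z.1 / 2 - z.2| := by
      rw [Prod.dist_eq, Real.dist_eq, abs_sub_comm]; simp
    have h1 := hLa.dist_le_mul z (z.1, r z.1 / 2)
    have h2 := hLb.dist_le_mul z (z.1, r z.1 / 2)
    rw [hd, Real.dist_eq] at h1 h2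
    have h3 : |fderiv ℝ r z.1 v| ≤ |R| := (hR z (hDs hz)).trans (le_abs_self R)
    have : g z = (a z - a (z.1, r z.1 / 2)) * (fderiv ℝ r z.1 v / 2) -
        (b z - b (z.1, r z.1 / 2)) := by
      rw [htan z.1]; simp only [g]; ring
    rw [this]
    refine (abs_sub _ _).trans ?_
    rw [abs_mul, abs_div, abs_two]
    have h4 : |a z - a (z.1, r z.1 / 2)| * (|fderiv ℝ r z.1 v| / 2) ≤
        (La * |r z.1 / 2 - z.2|) * (|R| / 2) := by gcongr
    linarith
  obtain ⟨Cb, hCb⟩ := hbc.exists_bound_of_continuous hbc'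
  have hCb0 : 0 ≤ Cb := (norm_nonneg _).trans (hCb 0)
  let H : E × ℝ → V := fun z => (fderiv ℝ a z (v, 0) + fderiv ℝ b z (0, 1)) • W z +
      (a z • W' z (v, 0) + b z • W' z (0, 1))
  have hH : IntegrableOn H D :=
    (hsm hWi (hda.add hdb)).add ((hsm (hW'v _) hac').add (hsm (hW'v _) hbc'))
  let A : ℝ → V := fun ε => ∫ z in D, layerCutoff r ε z • H z
  let B : ℝ → V := fun ε => ∫ z in D, (smoothStep (z.2 / ε) *
      (deriv smoothStep ((r z.1 / 2 - z.2) / ε) / ε) * g z) • W z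
  let C₁ : ℝ → V := fun ε => ∫ z in D,
      (deriv smoothStep (z.2 / ε) / ε * (smoothStep ((r z.1 / 2 - z.2) / ε) * b z)) •
        (W z - u z.1)
  let C₂ : ℝ → V := fun ε => ∫ z in D,
      (deriv smoothStep (z.2 / ε) / ε * (smoothStep ((r z.1 / 2 - z.2) / ε) * b z)) • u z.1
  have hsum : ∀ ε : ℝ, 0 < ε → A ε + B ε + (C₁ ε + C₂ ε) = 0 := by
    intro ε hε
    have hκ := (contDiff_layerCutoff hr ε).continuous
    have e1 := hweak ε hε a ha (fun z h1 h2 => (hsupp z h1 h2).1) (v, 0)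
    have e2 := hweak ε hε b hb (fun z h1 h2 => (hsupp z h1 h2).2) (0, 1)
    rw [eq_neg_iff_add_eq_zero] at e1 e2
    have hκa : Continuous fun z => fderiv ℝ (fun z => layerCutoff r ε z * a z) z (v, 0) :=
      (((contDiff_layerCutoff hr ε).mul ha).continuous_fderiv (by simp)).clm_apply
        continuous_const
    have hκb : Continuous fun z => fderiv ℝ (fun z => layerCutoff r ε z * b z) z (0, 1) :=
      (((contDiff_layerCutoff hr ε).mul hb).continuous_fderiv (by simp)).clm_apply
        continuous_const
    have i1 := hsm hWi hκa
    have i2 := hsm hWi hκb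
    have i3 : IntegrableOn (fun z => (layerCutoff r ε z * a z) • W' z (v, 0)) D :=
      hsm (hW'v (v, 0)) (hκ.mul hac')
    have i4 : IntegrableOn (fun z => (layerCutoff r ε z * b z) • W' z (0, 1)) D :=
      hsm (hW'v (0, 1)) (hκ.mul hbc')
    have j1 := hsm hH hκ
    have j2 : IntegrableOn (fun z => (smoothStep (z.2 / ε) *
      (deriv smoothStep ((r z.1 / 2 - z.2) / ε) / ε) * g z) • W z) D := hsm hWi (by fun_prop)
    have j3 : IntegrableOn (fun z : E × ℝ =>
      (deriv smoothStep (z.2 / ε) / ε * (smoothStep ((r z.1 / 2 - z.2) / ε) * b z)) •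
        (W z - u z.1)) D := hsm (hWi.sub hui) (by fun_prop)
    have j4 : IntegrableOn (fun z : E × ℝ =>
      (deriv smoothStep (z.2 / ε) / ε * (smoothStep ((r z.1 / 2 - z.2) / ε) * b z)) •
        u z.1) D := hsm hui (by fun_prop)
    have e3 := congrArg₂ (· + ·) e1 e2
    simp only [add_zero] at e3
    rw [← integral_add' i1 i3, ← integral_add' i2 i4, ← integral_add' (i1.add i3) (i2.add i4)] at e3
    rw [← integral_add' j1 j2, ← integral_add' j3 j4, ← integral_add' (j1.add j2) (j3.add j4), ← e3]
    refine integral_congr_ae (Eventually.of_forall fun z => ?_)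
    simp only [Pi.add_apply, fderiv_layerCutoff_mul hr ha, fderiv_layerCutoff_mul hr hb, H, g,
      map_zero]
    module
  have hA : Tendsto A (𝓝[>] 0) (𝓝 (∫ z in layer r ∩ K ×ˢ univ, H z)) := by
    have hset : layer r ∩ K ×ˢ univ = D ∩ layer r := by
      ext z
      constructor
      · rintro ⟨h1, h2, -⟩
        exact ⟨⟨h2, h1.1, by linarith [h1.2, hr1 z.1 h2]⟩, h1⟩
      · rintro ⟨h1, h2⟩
        exact ⟨h2, h1.1, mem_univ _⟩
    rw [hset, ← setIntegral_indicator (measurableSet_layer hrc.measurable)]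
    refine tendsto_integral_filter_of_dominated_convergence (fun z => ‖H z‖) ?_ ?_ hH.norm ?_
    · exact Eventually.of_forall fun ε =>
        (contDiff_layerCutoff hr ε).continuous.aestronglyMeasurable.smul hH.1
    · refine Eventually.of_forall fun ε => Eventually.of_forall fun z => ?_
      rw [norm_smul]
      exact mul_le_of_le_one_left (norm_nonneg _) (abs_layerCutoff_le r ε z)
    · refine Eventually.of_forall fun z => ?_
      have := (tendsto_layerCutoff r z).smul_const (H z)
      by_cases hz : z ∈ layer r
      · simpa [hz] using this
      · simpa [hz] using this
  have hB : Tendsto B (𝓝[>] 0) (𝓝 0) := tendsto_integral_upper hDm hWi hrc hg hgL hL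
  have hC₁ : Tendsto C₁ (𝓝[>] 0) (𝓝 0) := by
    refine tendsto_integral_lower_sub hK.measurableSet htr hCb0 fun ε z => ?_
    rw [abs_mul]
    calc _ ≤ 1 * Cb := by
          gcongr
          · exact abs_smoothStep_le_one _
          · exact hCb z
      _ = Cb := one_mul _
  have hC₂ : Tendsto C₂ (𝓝[>] 0) (𝓝 (∫ y in K ∩ {y | 0 < r y}, b (y, 0) • u y)) :=
    tendsto_integral_lower hK hu hr hb hbc
  have hlim := (hA.add hB).add (hC₁.add hC₂)
  have hzero : Tendsto (fun ε => A ε + B ε + (C₁ ε + C₂ ε)) (𝓝[>] 0) (𝓝 0) :=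
    tendsto_const_nhds.congr' (by
      filter_upwards [self_mem_nhdsWithin] with ε hε using (hsum ε hε).symm)
  have := tendsto_nhds_unique hlim hzero
  rw [add_zero, zero_add] at this
  exact eq_neg_of_add_eq_zero_left this

end Green

/-! ### The derivative of the glued map -/

section CellMap

variable {T V : Type*} [TopologicalSpace T] [AddCommGroup T] [Module ℝ T]

/-- The differential of `(x, t) ↦ (x, c (t - s x))`, where `ℓ` is the differential of `s`. -/
def cellMap (ℓ : T →L[ℝ] ℝ) (c : ℝ) : T × ℝ →L[ℝ] T × ℝ :=
  (ContinuousLinearMap.fst ℝ T ℝ).prod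
    (c • (ContinuousLinearMap.snd ℝ T ℝ - ℓ.comp (ContinuousLinearMap.fst ℝ T ℝ)))

@[simp] lemma cellMap_apply (ℓ : T →L[ℝ] ℝ) (c : ℝ) (v : T × ℝ) :
    cellMap ℓ c v = (v.1, c * (v.2 - ℓ v.1)) := rfl

end CellMap

section EuclideanGlue

variable {E V : Type*} [NormedAddCommGroup E] [NormedSpace ℝ E] [MeasureSpace E] [BorelSpace E]
  [SecondCountableTopology E] [SFinite (volume : Measure E)]
  [NormedAddCommGroup V] [NormedSpace ℝ V]

/-- The derivative of `glue N ρ W`, given the derivatives `W'` of the `W`. -/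
def glueDeriv (N : ℕ) (ρ : ℕ → E → ℝ) (W' : ℕ → E × ℝ → E × ℝ →L[ℝ] V) (z : E × ℝ) :
    E × ℝ →L[ℝ] V :=
  ∑ k ∈ Finset.range N, ∑ b : Bool, (halfCell ρ k b).indicator
    (fun z => (W' k (z.1, depth ρ k b z)).comp
      (cellMap (fderiv ℝ (base ρ k b) z.1) (orient b))) z

lemma contDiff_base {ρ : ℕ → E → ℝ} (hρ : ∀ k, ContDiff ℝ ∞ (ρ k)) (k : ℕ) (b : Bool) :
    ContDiff ℝ ∞ (base ρ k b) :=
  ContDiff.sum fun i _ => hρ i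

lemma fderiv_base_true {ρ : ℕ → E → ℝ} (hρ : ∀ k, ContDiff ℝ ∞ (ρ k)) (k : ℕ) (y : E) :
    fderiv ℝ (base ρ k true) y = fderiv ℝ (base ρ k false) y + fderiv ℝ (ρ k) y := by
  have : base ρ k true = base ρ k false + ρ k := funext fun y => base_true ρ k y
  rw [this, fderiv_add]
  · exact (contDiff_base hρ k false).differentiable (by simp) y
  · exact (hρ k).differentiable (by simp) y

lemma integrableOn_halfCell {Y : Type*} [NormedAddCommGroup Y] {ρ : ℕ → E → ℝ}
    (hρ : ∀ k, Measurable (ρ k)) {K : Set E} {F : E × ℝ → Y} {k : ℕ} (hρ1 : ∀ y ∈ K, ρ k y ≤ 1)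
    (hF : IntegrableOn F (K ×ˢ Ioo 0 (1 / 2))) (b : Bool) :
    IntegrableOn (fun z => F (z.1, depth ρ k b z)) (halfCell ρ k b ∩ K ×ˢ univ) := by
  have h : IntegrableOn F (layer (ρ k) ∩ K ×ˢ univ) := by
    refine hF.mono_set ?_
    rintro z ⟨h1, h2, -⟩
    exact ⟨h2, h1.1, by linarith [h1.2, hρ1 z.1 h2]⟩
  exact (((measurePreserving_cellShear (volume : Measure E) hρ k b).symm _).integrableOn_comp_preimage
    (cellShear hρ k b).symm.measurableEmbedding).2 h

lemma integrableOn_indicator_halfCell {Y : Type*} [NormedAddCommGroup Y] {ρ : ℕ → E → ℝ}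
    (hρ : ∀ k, Measurable (ρ k)) {K₀ K : Set E} {k : ℕ} {b : Bool} {F : E × ℝ → Y}
    (hK : ∀ y ∈ K₀, 0 < ρ k y → y ∈ K)
    (hF : IntegrableOn F (halfCell ρ k b ∩ K ×ˢ univ)) :
    IntegrableOn ((halfCell ρ k b).indicator F) (K₀ ×ˢ univ) := by
  have hm := measurableSet_halfCell hρ k b
  rw [IntegrableOn, integrable_indicator_iff hm, IntegrableOn, Measure.restrict_restrict hm]
  refine hF.mono_set ?_
  rintro z ⟨h1, h2, -⟩
  exact ⟨h1, hK _ h2 (by linarith [h1.1, h1.2]), mem_univ _⟩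

lemma integrableOn_sum_halfCell {Y : Type*} [NormedAddCommGroup Y] {N : ℕ} {ρ : ℕ → E → ℝ}
    (hρ : ∀ k, Measurable (ρ k)) {K₀ : Set E} {K : ℕ → Set E}
    (hK : ∀ k < N, ∀ y ∈ K₀, 0 < ρ k y → y ∈ K k) {F : ℕ → Bool → E × ℝ → Y}
    (hF : ∀ k < N, ∀ b, IntegrableOn (F k b) (halfCell ρ k b ∩ K k ×ˢ univ)) :
    IntegrableOn (fun z => ∑ k ∈ Finset.range N, ∑ b : Bool,
      (halfCell ρ k b).indicator (F k b) z) (K₀ ×ˢ univ) := by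
  refine integrable_finsetSum _ fun k hk => integrable_finsetSum _ fun b _ => ?_
  rw [Finset.mem_range] at hk
  exact integrableOn_indicator_halfCell hρ (hK k hk) (hF k hk b)

lemma integrableOn_glue {N : ℕ} {ρ : ℕ → E → ℝ} (hρ : ∀ k, Measurable (ρ k)) {K₀ : Set E}
    {K : ℕ → Set E} (hρ1 : ∀ k < N, ∀ y ∈ K k, ρ k y ≤ 1)
    (hK : ∀ k < N, ∀ y ∈ K₀, 0 < ρ k y → y ∈ K k) {W : ℕ → E × ℝ → V}
    (hW : ∀ k < N, IntegrableOn (W k) (K k ×ˢ Ioo 0 (1 / 2))) :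
    IntegrableOn (glue N ρ W) (K₀ ×ˢ univ) :=
  integrableOn_sum_halfCell hρ hK fun k hk b => integrableOn_halfCell hρ (hρ1 k hk) (hW k hk) b

lemma integrableOn_cellMap_halfCell {ρ : ℕ → E → ℝ} (hρ : ∀ k, ContDiff ℝ ∞ (ρ k)) {K : Set E}
    (hKc : IsCompact K) {F : E × ℝ → E × ℝ →L[ℝ] V} {k : ℕ} (hρ1 : ∀ y ∈ K, ρ k y ≤ 1)
    (hF : IntegrableOn F (K ×ˢ Ioo 0 (1 / 2))) (b : Bool) :
    IntegrableOn (fun z => (F (z.1, depth ρ k b z)).comp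
      (cellMap (fderiv ℝ (base ρ k b) z.1) (orient b))) (halfCell ρ k b ∩ K ×ˢ univ) := by
  have hm : ∀ k, Measurable (ρ k) := fun k => (hρ k).continuous.measurable
  have hi := integrableOn_halfCell hm hρ1 hF b
  have hc : Continuous fun y : E => cellMap (fderiv ℝ (base ρ k b) y) (orient b) := by
    have h1 : Continuous (fderiv ℝ (base ρ k b)) := (contDiff_base hρ k b).continuous_fderiv (by simp)
    have h2 : ∀ y, cellMap (fderiv ℝ (base ρ k b) y) (orient b) =
        (ContinuousLinearMap.fst ℝ E ℝ).prod (orient b • ContinuousLinearMap.snd ℝ E ℝ) -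
        (orient b • ContinuousLinearMap.inr ℝ E ℝ).comp
          ((fderiv ℝ (base ρ k b) y).comp (ContinuousLinearMap.fst ℝ E ℝ)) := by
      intro y
      refine ContinuousLinearMap.ext fun w => ?_
      simp [mul_sub]
    simp only [h2]
    exact continuous_const.sub (continuous_const.clm_comp (h1.clm_comp continuous_const))
  obtain ⟨C, hC⟩ := hKc.exists_bound_of_continuousOn hc.continuousOn
  refine Integrable.mono' (hi.norm.mul_const C) ?_ ?_
  · exact (isBoundedBilinearMap_comp (𝕜 := ℝ) (E := E × ℝ) (F := E × ℝ)
      (G := V)).continuous.comp_aestronglyMeasurable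
        (hi.1.prodMk (hc.comp continuous_fst).aestronglyMeasurable)
  · filter_upwards [ae_restrict_mem ((measurableSet_halfCell hm k b).inter
      (hKc.measurableSet.prod MeasurableSet.univ))] with z hz
    refine (ContinuousLinearMap.opNorm_comp_le _ _).trans ?_
    gcongr
    exact hC _ hz.2.1

lemma integrableOn_glueDeriv {N : ℕ} {ρ : ℕ → E → ℝ} (hρ : ∀ k, ContDiff ℝ ∞ (ρ k)) {K₀ : Set E}
    {K : ℕ → Set E} (hKc : ∀ k < N, IsCompact (K k)) (hρ1 : ∀ k < N, ∀ y ∈ K k, ρ k y ≤ 1)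
    (hK : ∀ k < N, ∀ y ∈ K₀, 0 < ρ k y → y ∈ K k) {W' : ℕ → E × ℝ → E × ℝ →L[ℝ] V}
    (hW' : ∀ k < N, IntegrableOn (W' k) (K k ×ˢ Ioo 0 (1 / 2))) :
    IntegrableOn (glueDeriv N ρ W') (K₀ ×ˢ univ) :=
  integrableOn_sum_halfCell (fun k => (hρ k).continuous.measurable) hK fun k hk b =>
    integrableOn_cellMap_halfCell hρ (hKc k hk) (hρ1 k hk) (hW' k hk) b

/-- The component of the field `ψ v` along the normal `(- d (base ρ k b), 1)` to the boundary
`t = base ρ k b` of a cell. -/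
def boundaryFlux (ρ : ℕ → E → ℝ) (ψ : E × ℝ → ℝ) (v : E × ℝ) (k : ℕ) (b : Bool) (y : E) : ℝ :=
  (v.2 - fderiv ℝ (base ρ k b) y v.1) * ψ (y, base ρ k b y)

/-- Green's formula on a cell: folding the two half cells onto the layer turns the constant field
`ψ v` into a field which is tangent to the upper boundary of the layer. -/
lemma sum_integral_halfCell [CompleteSpace V] {ρ : ℕ → E → ℝ} (hρ : ∀ k, ContDiff ℝ ∞ (ρ k))
    {K₀ K Ω : Set E} {k : ℕ}
    (hΩ : IsOpen Ω) (hKc : IsCompact K) (hKΩ : K ⊆ Ω) (hρ1 : ∀ y ∈ K, ρ k y ≤ 1)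
    (hK : ∀ y ∈ K₀, 0 < ρ k y → y ∈ K) {W : E × ℝ → V} {W' : E × ℝ → E × ℝ →L[ℝ] V} {u : E → V}
    (hWW' : IsWeakFDerivOn (Ω ×ˢ Ioo 0 1) W W')
    (hW : IntegrableOn W (K ×ˢ Ioo 0 (1 / 2))) (hW' : IntegrableOn W' (K ×ˢ Ioo 0 (1 / 2)))
    (hu : IntegrableOn u K)
    (htr : Tendsto (fun ε : ℝ => (ENNReal.ofReal ε)⁻¹ *
      ∫⁻ z in K ×ˢ Ioo 0 ε, ‖W z - u z.1‖ₑ) (𝓝[>] 0) (𝓝 0))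
    {ψ : E × ℝ → ℝ} (hψ : ContDiff ℝ ∞ ψ) (hψc : HasCompactSupport ψ)
    (hψK : tsupport ψ ⊆ K₀ ×ˢ univ) (v : E × ℝ) :
    ∑ b : Bool, ∫ z in halfCell ρ k b, (fderiv ℝ ψ z v • W (z.1, depth ρ k b z) +
        ψ z • W' (z.1, depth ρ k b z) (cellMap (fderiv ℝ (base ρ k b) z.1) (orient b) v)) =
      - ∫ y in K ∩ {y | 0 < ρ k y},
          (boundaryFlux ρ ψ v k false y - boundaryFlux ρ ψ v k true y) • u y := by
  have hm : ∀ k, Measurable (ρ k) := fun k => (hρ k).continuous.measurable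
  let Φ : Bool → E × ℝ → E × ℝ := fun b z => (z.1, base ρ k b z.1 + orient b * z.2)
  have hbase := contDiff_base hρ k
  have hΦ : ∀ b, ContDiff ℝ ∞ (Φ b) := fun b =>
    contDiff_fst.prodMk (((hbase b).comp contDiff_fst).add (contDiff_const.mul contDiff_snd))
  let a : Bool → E × ℝ → ℝ := fun b z => ψ (Φ b z)
  let n : Bool → E → ℝ := fun b y => orient b * (v.2 - fderiv ℝ (base ρ k b) y v.1)
  let β : Bool → E × ℝ → ℝ := fun b z => n b z.1 * a b z
  have ha : ∀ b, ContDiff ℝ ∞ (a b) := fun b => hψ.comp (hΦ b)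
  have hn : ∀ b, ContDiff ℝ ∞ (n b) := fun b =>
    contDiff_const.mul (contDiff_const.sub
      (((hbase b).fderiv_right (m := ∞) (by simp)).clm_apply contDiff_const))
  have hβ : ∀ b, ContDiff ℝ ∞ (β b) := fun b => ((hn b).comp contDiff_fst).mul (ha b)
  have hac : ∀ b, HasCompactSupport (a b) := by
    intro b
    have hcont : Continuous fun z : E × ℝ => (z.1, depth ρ k b z) := by
      have := (hbase b).continuous
      unfold depth; fun_prop
    refine HasCompactSupport.intro (hψc.isCompact.image hcont) fun z hz => ?_
    by_contra h
    refine hz ⟨Φ b z, subset_tsupport ψ h, ?_⟩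
    exact Prod.ext rfl (depth_cellShear k b z.1 z.2)
  have hβc : ∀ b, HasCompactSupport (β b) := fun b => (hac b).mul_left
  -- `a b` vanishes over points outside `K₀`
  have ha0 : ∀ b z, z.1 ∉ K₀ → a b z = 0 := fun b z hz =>
    image_eq_zero_of_notMem_tsupport (f := ψ) (x := Φ b z) fun h => hz (hψK h).1
  have hΦd : ∀ b z w, fderiv ℝ (a b) z w =
      fderiv ℝ ψ (Φ b z) (w.1, fderiv ℝ (base ρ k b) z.1 w.1 + orient b * w.2) := by
    intro b z w
    have h1 : HasFDerivAt (fun z : E × ℝ => base ρ k b z.1)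
        ((fderiv ℝ (base ρ k b) z.1).comp (ContinuousLinearMap.fst ℝ E ℝ)) z :=
      (((hbase b).differentiable (by simp) z.1).hasFDerivAt).comp z hasFDerivAt_fst
    have h2 : HasFDerivAt (Φ b) ((ContinuousLinearMap.fst ℝ E ℝ).prod
        ((fderiv ℝ (base ρ k b) z.1).comp (ContinuousLinearMap.fst ℝ E ℝ) +
          orient b • ContinuousLinearMap.snd ℝ E ℝ)) z :=
      hasFDerivAt_fst.prodMk (h1.add (hasFDerivAt_snd.const_smul (orient b)))
    have h3 := ((hψ.differentiable (by simp) (Φ b z)).hasFDerivAt).comp z h2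
    have h4 : fderiv ℝ (a b) z = _ := h3.fderiv
    rw [h4]; rfl
  have hβd : ∀ b z, fderiv ℝ (β b) z (0, 1) = n b z.1 * fderiv ℝ (a b) z (0, 1) := by
    intro b z
    have h1 : HasFDerivAt (fun z : E × ℝ => n b z.1)
        ((fderiv ℝ (n b) z.1).comp (ContinuousLinearMap.fst ℝ E ℝ)) z :=
      (((hn b).differentiable (by simp) z.1).hasFDerivAt).comp z hasFDerivAt_fst
    have h2 := h1.mul ((ha b).differentiable (by simp) z).hasFDerivAt
    have h3 : fderiv ℝ (β b) z = _ := h2.fderiv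
    rw [h3]; simp
  -- the integrand over a half cell, in the coordinates of the layer
  let P : Bool → E × ℝ → V := fun b z =>
    (fderiv ℝ (a b) z (v.1, 0) + fderiv ℝ (β b) z (0, 1)) • W z +
      (a b z • W' z (v.1, 0) + β b z • W' z (0, 1))
  have hcell : ∀ b, ∫ z in halfCell ρ k b, (fderiv ℝ ψ z v • W (z.1, depth ρ k b z) +
        ψ z • W' (z.1, depth ρ k b z) (cellMap (fderiv ℝ (base ρ k b) z.1) (orient b) v)) =
      ∫ z in layer (ρ k) ∩ K ×ˢ univ, P b z := by
    intro b
    have e1 := (measurePreserving_cellShear (volume : Measure E) hm k b).setIntegral_preimage_emb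
      (cellShear hm k b).measurableEmbedding
      (fun z => fderiv ℝ ψ z v • W (z.1, depth ρ k b z) + ψ z • W' (z.1, depth ρ k b z)
        (cellMap (fderiv ℝ (base ρ k b) z.1) (orient b) v)) (halfCell ρ k b)
    rw [Measure.volume_eq_prod, ← e1, cellShear_preimage_halfCell, ← Measure.volume_eq_prod]
    have e2 : ∀ z : E × ℝ, fderiv ℝ ψ (cellShear hm k b z) v •
        W ((cellShear hm k b z).1, depth ρ k b (cellShear hm k b z)) +
        ψ (cellShear hm k b z) • W' ((cellShear hm k b z).1, depth ρ k b (cellShear hm k b z))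
          (cellMap (fderiv ℝ (base ρ k b) (cellShear hm k b z).1) (orient b) v) = P b z := by
      intro z
      simp only [cellShear_apply, depth_cellShear, cellMap_apply]
      have hsplit : ((v.1, orient b * (v.2 - fderiv ℝ (base ρ k b) z.1 v.1)) : E × ℝ) =
          (v.1, (0 : ℝ)) + n b z.1 • ((0 : E), (1 : ℝ)) := by
        ext <;> simp [n]
      have hvsplit : fderiv ℝ ψ (Φ b z) v = fderiv ℝ (a b) z (v.1, 0) +
          n b z.1 * fderiv ℝ (a b) z (0, 1) := by
        have hv : v = (v.1, fderiv ℝ (base ρ k b) z.1 v.1 + orient b * 0) +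
            n b z.1 • ((0 : E), fderiv ℝ (base ρ k b) z.1 0 + orient b * 1) := by
          ext
          · simp
          · simp only [n, map_zero, Prod.snd_add, Prod.smul_snd, smul_eq_mul]
            linear_combination (-(v.2 - fderiv ℝ (base ρ k b) z.1 v.1)) * orient_mul_self b
        rw [hΦd, hΦd]
        conv_lhs => rw [hv, map_add, map_smul]
        rfl
      rw [hsplit, map_add, map_smul]
      simp only [P, hβd, β]
      rw [show ψ (z.1, base ρ k b z.1 + orient b * z.2) = a b z from rfl,
        show fderiv ℝ ψ (z.1, base ρ k b z.1 + orient b * z.2) v = _ from hvsplit]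
      module
    simp only [e2]
    refine setIntegral_eq_of_subset_of_forall_sdiff_eq_zero (measurableSet_layer (hm k))
      inter_subset_left ?_
    rintro z ⟨hz, hzK⟩
    have hz0 : z.1 ∉ K₀ := fun h => hzK ⟨hz, hK _ h (by linarith [hz.1, hz.2]), mem_univ _⟩
    have hψ0 : Φ b z ∉ tsupport ψ := fun h => hz0 (hψK h).1
    have hd0 : fderiv ℝ ψ (Φ b z) = 0 :=
      Function.notMem_support.1 fun h => hψ0 (support_fderiv_subset ℝ h)
    simp only [P, hβd, hΦd, hd0, β, ha0 b z hz0]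
    simp
  have hDc : IsCompact (K ×ˢ Icc (0 : ℝ) (1 / 2)) := hKc.prod isCompact_Icc
  have hDm : MeasurableSet (K ×ˢ Ioo (0 : ℝ) (1 / 2)) := hKc.measurableSet.prod measurableSet_Ioo
  have hDs : K ×ˢ Ioo (0 : ℝ) (1 / 2) ⊆ K ×ˢ Icc (0 : ℝ) (1 / 2) :=
    prod_mono_right Ioo_subset_Icc_self
  have hPi : ∀ b, IntegrableOn (P b) (layer (ρ k) ∩ K ×ˢ univ) := by
    intro b
    have hW'v : ∀ w, IntegrableOn (fun z => W' z w) (K ×ˢ Ioo (0 : ℝ) (1 / 2)) := fun w =>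
      ((ContinuousLinearMap.apply ℝ V w).integrable_comp hW')
    have h1 : Continuous fun z => fderiv ℝ (a b) z (v.1, 0) + fderiv ℝ (β b) z (0, 1) :=
      (((ha b).continuous_fderiv (by simp)).clm_apply continuous_const).add
        (((hβ b).continuous_fderiv (by simp)).clm_apply continuous_const)
    have : IntegrableOn (P b) (K ×ˢ Ioo (0 : ℝ) (1 / 2)) :=
      (integrableOn_continuous_smul_of_subset hW hDm hDc hDs h1).add
        ((integrableOn_continuous_smul_of_subset (hW'v _) hDm hDc hDs (ha b).continuous).add
          (integrableOn_continuous_smul_of_subset (hW'v _) hDm hDc hDs (hβ b).continuous))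
    refine this.mono_set ?_
    rintro z ⟨h1, h2, -⟩
    exact ⟨h2, h1.1, by linarith [h1.2, hρ1 z.1 h2]⟩
  have hgreen := green_layer (a := fun z => a false z + a true z)
    (b := fun z => β false z + β true z) (v := v.1) hΩ hWW' hKc hKΩ hW hW' hu htr (hρ k) hρ1
    ((ha false).add (ha true)) ((hac false).add (hac true)) ((hβ false).add (hβ true))
    ((hβc false).add (hβc true)) ?_ ?_
  · simp only [hcell, Fintype.sum_bool]
    rw [← integral_add (hPi true) (hPi false)]
    convert hgreen using 1
    · refine integral_congr_ae (Eventually.of_forall fun z => ?_)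
      have d1 : fderiv ℝ (fun z => a false z + a true z) z = fderiv ℝ (a false) z +
          fderiv ℝ (a true) z :=
        fderiv_fun_add ((ha _).differentiable (by simp) z) ((ha _).differentiable (by simp) z)
      have d2 : fderiv ℝ (fun z => β false z + β true z) z = fderiv ℝ (β false) z +
          fderiv ℝ (β true) z :=
        fderiv_fun_add ((hβ _).differentiable (by simp) z) ((hβ _).differentiable (by simp) z)
      simp only [d1, d2, P, add_apply]
      module
    · congr 2
      ext y
      congr 1
      simp [boundaryFlux, β, n, a, Φ, orient]
      ring
  · intro z hz hr
    have hz0 : z.1 ∉ K₀ := fun h => hz (hK _ h hr)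
    simp [β, ha0 _ z hz0]
  · intro y
    have e : ∀ b, a b (y, ρ k y / 2) = ψ (y, base ρ k false y + ρ k y / 2) := by
      intro b
      cases b
      · simp [a, Φ, orient]
      · simp only [a, Φ, orient, base_true, if_true]
        congr 2; ring
    simp only [β, e, n, fderiv_base_true hρ, orient, add_apply]
    simp
    ring

end EuclideanGlue

/-! ### Gluing in a Euclidean space -/

section EuclideanGlue

variable {E V : Type*} [NormedAddCommGroup E] [NormedSpace ℝ E] [MeasureSpace E] [BorelSpace E]
  [SecondCountableTopology E] [SFinite (volume : Measure E)]
  [NormedAddCommGroup V] [NormedSpace ℝ V]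

/-- `W` is weakly differentiable on `Ω × (0, 1)` with derivative `W'` and, over the compact set `K`,
integrable up to the boundary `{t = 0}` together with `W'`, with trace `u` there. -/
structure IsExtensionOver (Ω K : Set E) (W : E × ℝ → V) (W' : E × ℝ → E × ℝ →L[ℝ] V)
    (u : E → V) : Prop where
  isOpen : IsOpen Ω
  isCompact : IsCompact K
  subset : K ⊆ Ω
  weak : IsWeakFDerivOn (Ω ×ˢ Ioo 0 1) W W'
  integrableOn : IntegrableOn W (K ×ˢ Ioo 0 (1 / 2))
  integrableOn_deriv : IntegrableOn W' (K ×ˢ Ioo 0 (1 / 2))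
  integrableOn_trace : IntegrableOn u K
  trace : Tendsto (fun ε : ℝ => (ENNReal.ofReal ε)⁻¹ *
      ∫⁻ z in K ×ˢ Ioo 0 ε, ‖W z - u z.1‖ₑ) (𝓝[>] 0) (𝓝 0)

lemma continuous_boundaryFlux {ρ : ℕ → E → ℝ} (hρ : ∀ k, ContDiff ℝ ∞ (ρ k)) {ψ : E × ℝ → ℝ}
    (hψ : Continuous ψ) (v : E × ℝ) (k : ℕ) (b : Bool) : Continuous (boundaryFlux ρ ψ v k b) := by
  have h1 := (contDiff_base hρ k b).continuous
  have h2 : Continuous fun y => fderiv ℝ (base ρ k b) y v.1 :=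
    ((contDiff_base hρ k b).continuous_fderiv (by simp)).clm_apply continuous_const
  unfold boundaryFlux
  fun_prop

lemma boundaryFlux_succ_false (ρ : ℕ → E → ℝ) (ψ : E × ℝ → ℝ) (v : E × ℝ) (k : ℕ) (y : E) :
    boundaryFlux ρ ψ v (k + 1) false y = boundaryFlux ρ ψ v k true y := by
  have : base ρ (k + 1) false = base ρ k true := funext (base_succ_false ρ k)
  simp only [boundaryFlux, this]

/-- The boundary terms of the cells cancel: the upper boundary of each cell is the lower boundary
of the next, and where the `k`-th cell is empty, `ρ k` is minimal and its two boundaries agree to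
first order. -/
lemma sum_boundaryFlux_eq_zero {N : ℕ} {ρ : ℕ → E → ℝ} (hρ : ∀ k, ContDiff ℝ ∞ (ρ k))
    (h0 : ∀ k y, 0 ≤ ρ k y) {K₀ : Set E} (h1 : ∀ y ∈ K₀, ∑ k ∈ Finset.range N, ρ k y = 1)
    {K : ℕ → Set E} (hK : ∀ k < N, ∀ y ∈ K₀, 0 < ρ k y → y ∈ K k) {ψ : E × ℝ → ℝ}
    (hψK : tsupport ψ ⊆ K₀ ×ˢ Ioo 0 1) (v : E × ℝ) (u : E → V) (y : E) :
    ∑ k ∈ Finset.range N, (K k ∩ {y | 0 < ρ k y}).indicator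
      (fun y => (boundaryFlux ρ ψ v k false y - boundaryFlux ρ ψ v k true y) • u y) y = 0 := by
  by_cases hy : y ∈ K₀
  · have hz : ∀ t : ℝ, t ∉ Ioo (0 : ℝ) 1 → ψ (y, t) = 0 := fun t ht =>
      image_eq_zero_of_notMem_tsupport fun h => ht (hψK h).2
    have hterm : ∀ k ∈ Finset.range N, (K k ∩ {y | 0 < ρ k y}).indicator
        (fun y => (boundaryFlux ρ ψ v k false y - boundaryFlux ρ ψ v k true y) • u y) y =
        (boundaryFlux ρ ψ v k false y - boundaryFlux ρ ψ v (k + 1) false y) • u y := by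
      intro k hk
      rw [boundaryFlux_succ_false]
      rcases (h0 k y).lt_or_eq with hpos | hzero
      · rw [indicator_of_mem]
        exact ⟨hK k (Finset.mem_range.1 hk) y hy hpos, hpos⟩
      · rw [indicator_of_notMem fun h => h.2.ne hzero]
        have hmin : IsLocalMin (ρ k) y := Eventually.of_forall fun x => by
          rw [← hzero]; exact h0 k x
        have hb : base ρ k true y = base ρ k false y := by rw [base_true, ← hzero, add_zero]
        have hd : fderiv ℝ (base ρ k true) y = fderiv ℝ (base ρ k false) y := by
          rw [fderiv_base_true hρ, hmin.fderiv_eq_zero, add_zero]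
        simp [boundaryFlux, hb, hd]
    rw [Finset.sum_congr rfl hterm, ← Finset.sum_smul, Finset.sum_range_sub']
    have hN : base ρ N false y = 1 := by simpa [base] using h1 y hy
    simp [boundaryFlux, hN, base_zero, hz 0 (by simp), hz 1 (by simp)]
  · have hz : ∀ t, ψ (y, t) = 0 := fun t =>
      image_eq_zero_of_notMem_tsupport fun h => hy (hψK h).1
    refine Finset.sum_eq_zero fun k _ => ?_
    simp [boundaryFlux, hz]

/-- The glued map satisfies the identity that defines the weak derivative, for test functions
supported over `K₀`. -/
lemma integral_glue [CompleteSpace V] {N : ℕ} {ρ : ℕ → E → ℝ} (hρ : ∀ k, ContDiff ℝ ∞ (ρ k))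
    (h0 : ∀ k y, 0 ≤ ρ k y) {K₀ : Set E}
    (h1 : ∀ y ∈ K₀, ∑ k ∈ Finset.range N, ρ k y = 1)
    {Ω K : ℕ → Set E} (hρ1 : ∀ k < N, ∀ y ∈ K k, ρ k y ≤ 1)
    (hK : ∀ k < N, ∀ y ∈ K₀, 0 < ρ k y → y ∈ K k)
    {W : ℕ → E × ℝ → V} {W' : ℕ → E × ℝ → E × ℝ →L[ℝ] V} {u : E → V}
    (hW : ∀ k < N, IsExtensionOver (Ω k) (K k) (W k) (W' k) u)
    {ψ : E × ℝ → ℝ} (hψ : ContDiff ℝ ∞ ψ) (hψc : HasCompactSupport ψ)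
    (hψK : tsupport ψ ⊆ K₀ ×ˢ Ioo 0 1) (v : E × ℝ) :
    ∫ z, fderiv ℝ ψ z v • glue N ρ W z = - ∫ z, ψ z • glueDeriv N ρ W' z v := by
  have hm : ∀ k, Measurable (ρ k) := fun k => (hρ k).continuous.measurable
  have hψK' : tsupport ψ ⊆ K₀ ×ˢ univ := hψK.trans (prod_mono_right (subset_univ _))
  have hfc : Continuous fun z => fderiv ℝ ψ z v :=
    (hψ.continuous_fderiv (by simp)).clm_apply continuous_const
  have hfcs : HasCompactSupport fun z => fderiv ℝ ψ z v := hψc.fderiv_apply ℝ v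
  have hψ0 : ∀ z, z ∉ K₀ ×ˢ univ → ψ z = 0 := fun z hz =>
    image_eq_zero_of_notMem_tsupport fun h => hz (hψK' h)
  have hf0 : ∀ z, z ∉ K₀ ×ˢ univ → fderiv ℝ ψ z v = 0 := fun z hz => by
    rw [show fderiv ℝ ψ z = 0 from
      Function.notMem_support.1 fun h => hz (hψK' (support_fderiv_subset ℝ h))]
    rfl
  obtain ⟨C₁, hC₁⟩ := hψc.exists_bound_of_continuous hψ.continuous
  obtain ⟨C₂, hC₂⟩ := hfcs.exists_bound_of_continuous hfc
  have hbdd : ∀ {Y : Type _} [NormedAddCommGroup Y] [NormedSpace ℝ Y] {f : E × ℝ → Y}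
      {g : E × ℝ → ℝ} {S : Set (E × ℝ)} (C : ℝ), Continuous g → (∀ z, ‖g z‖ ≤ C) →
      IntegrableOn f S → IntegrableOn (fun z => g z • f z) S := fun C hg hC hf =>
    Integrable.bdd_smul hf C hg.aestronglyMeasurable (Eventually.of_forall hC)
  have hI₁ : Integrable fun z => fderiv ℝ ψ z v • glue N ρ W z := by
    refine IntegrableOn.integrable_of_forall_notMem_eq_zero (hbdd C₂ hfc hC₂
      (integrableOn_glue hm hρ1 hK fun k hk => (hW k hk).integrableOn)) fun z hz => ?_
    rw [hf0 z hz, zero_smul]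
  have hI₂ : Integrable fun z => ψ z • glueDeriv N ρ W' z v := by
    refine IntegrableOn.integrable_of_forall_notMem_eq_zero (hbdd C₁ hψ.continuous hC₁
      (ContinuousLinearMap.integrable_comp (ContinuousLinearMap.apply ℝ V v)
        (integrableOn_glueDeriv hρ (fun k hk => (hW k hk).isCompact) hρ1 hK
          fun k hk => (hW k hk).integrableOn_deriv))) fun z hz => ?_
    rw [hψ0 z hz, zero_smul]
  rw [eq_neg_iff_add_eq_zero, ← integral_add hI₁ hI₂]
  let G : ℕ → Bool → E × ℝ → V := fun k b z =>
    fderiv ℝ ψ z v • W k (z.1, depth ρ k b z) +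
      ψ z • W' k (z.1, depth ρ k b z) (cellMap (fderiv ℝ (base ρ k b) z.1) (orient b) v)
  have hG : ∀ k < N, ∀ b, IntegrableOn (G k b) (halfCell ρ k b ∩ K k ×ˢ univ) := by
    intro k hk b
    refine (hbdd C₂ hfc hC₂ (integrableOn_halfCell hm (hρ1 k hk) (hW k hk).integrableOn b)).add
      (hbdd C₁ hψ.continuous hC₁ ?_)
    exact ContinuousLinearMap.integrable_comp (ContinuousLinearMap.apply ℝ V v)
      (integrableOn_cellMap_halfCell hρ (hW k hk).isCompact (hρ1 k hk)
        (hW k hk).integrableOn_deriv b)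
  have hGi : ∀ k < N, ∀ b, Integrable ((halfCell ρ k b).indicator (G k b)) := by
    intro k hk b
    refine IntegrableOn.integrable_of_forall_notMem_eq_zero
      (integrableOn_indicator_halfCell hm (hK k hk) (hG k hk b)) fun z hz => ?_
    simp [G, hψ0 z hz, hf0 z hz]
  have hsum : ∀ z, fderiv ℝ ψ z v • glue N ρ W z + ψ z • glueDeriv N ρ W' z v =
      ∑ k ∈ Finset.range N, ∑ b : Bool, (halfCell ρ k b).indicator (G k b) z := by
    intro z
    simp only [glue, glueDeriv, sum_apply, Finset.smul_sum,
      ← Finset.sum_add_distrib]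
    refine Finset.sum_congr rfl fun k _ => Finset.sum_congr rfl fun b _ => ?_
    by_cases hz : z ∈ halfCell ρ k b
    · simp only [indicator_of_mem hz]; rfl
    · simp [indicator_of_notMem hz]
  have hcell : ∀ k ∈ Finset.range N, ∫ z, ∑ b : Bool, (halfCell ρ k b).indicator (G k b) z =
      - ∫ y, (K k ∩ {y | 0 < ρ k y}).indicator (fun y =>
          (boundaryFlux ρ ψ v k false y - boundaryFlux ρ ψ v k true y) • u y) y := by
    intro k hk
    have hk := Finset.mem_range.1 hk
    rw [integral_finsetSum _ fun b _ => hGi k hk b, integral_indicator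
      ((hW k hk).isCompact.measurableSet.inter (measurableSet_lt measurable_const (hm k)))]
    simp only [integral_indicator (measurableSet_halfCell hm k _)]
    exact sum_integral_halfCell hρ (hW k hk).isOpen (hW k hk).isCompact (hW k hk).subset
      (hρ1 k hk) (hK k hk) (hW k hk).weak (hW k hk).integrableOn (hW k hk).integrableOn_deriv
      (hW k hk).integrableOn_trace (hW k hk).trace hψ hψc hψK' v
  simp only [hsum]
  rw [integral_finsetSum _ fun k hk => integrable_finsetSum _ fun b _ =>
    hGi k (Finset.mem_range.1 hk) b, Finset.sum_congr rfl hcell, Finset.sum_neg_distrib,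
    ← integral_finsetSum, neg_eq_zero]
  · simp only [sum_boundaryFlux_eq_zero hρ h0 h1 hK hψK v u, integral_zero]
  · intro k hk
    have hk := Finset.mem_range.1 hk
    rw [integrable_indicator_iff
      ((hW k hk).isCompact.measurableSet.inter (measurableSet_lt measurable_const (hm k)))]
    exact (integrableOn_continuous_smul_of_subset (hW k hk).integrableOn_trace
      (hW k hk).isCompact.measurableSet (hW k hk).isCompact subset_rfl
      ((continuous_boundaryFlux hρ hψ.continuous v k false).sub
        (continuous_boundaryFlux hρ hψ.continuous v k true))).mono_set inter_subset_left

lemma glue_congr {N : ℕ} {ρ ρ' : ℕ → E → ℝ} {z : E × ℝ} (h : ∀ k, ρ k z.1 = ρ' k z.1)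
    (W : ℕ → E × ℝ → V) : glue N ρ W z = glue N ρ' W z := by
  simp only [glue, indicator_apply, halfCell, depth, base, h, mem_ofPred_eq]

lemma glueDeriv_congr {N : ℕ} {ρ ρ' : ℕ → E → ℝ} {z : E × ℝ} (h : ∀ k, ρ k =ᶠ[𝓝 z.1] ρ' k)
    (W' : ℕ → E × ℝ → E × ℝ →L[ℝ] V) : glueDeriv N ρ W' z = glueDeriv N ρ' W' z := by
  have hb : ∀ k b, base ρ k b =ᶠ[𝓝 z.1] base ρ' k b := by
    intro k b
    have : ∀ᶠ y in 𝓝 z.1, ∀ i ∈ Finset.range (k + b.toNat), ρ i y = ρ' i y :=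
      (Finset.eventually_all _).2 fun i _ => h i
    filter_upwards [this] with y hy using Finset.sum_congr rfl hy
  simp only [glueDeriv, indicator_apply, halfCell, depth, (hb _ _).fderiv_eq, (hb _ _).eq_of_nhds,
    (h _).eq_of_nhds, mem_ofPred_eq]

/-- Gluing along a smooth partition of unity of an open set `Ω₀` preserves weak differentiability. -/
theorem isWeakFDerivOn_glue [FiniteDimensional ℝ E] [CompleteSpace V] {N : ℕ} {ρ : ℕ → E → ℝ}
    {Ω₀ : Set E} (hΩ₀ : IsOpen Ω₀)
    (hρ : ∀ k, ContDiffOn ℝ ∞ (ρ k) Ω₀) (h0 : ∀ k y, 0 ≤ ρ k y)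
    (h1 : ∀ y ∈ Ω₀, ∑ k ∈ Finset.range N, ρ k y = 1)
    {Ω : ℕ → Set E} {W : ℕ → E × ℝ → V} {W' : ℕ → E × ℝ → E × ℝ →L[ℝ] V} {u : E → V}
    (hW : ∀ K₀ ⊆ Ω₀, IsCompact K₀ → ∀ k < N, ∃ K, IsExtensionOver (Ω k) K (W k) (W' k) u ∧
      K ⊆ Ω₀ ∧ ∀ y ∈ K₀, 0 < ρ k y → y ∈ K) :
    IsWeakFDerivOn (Ω₀ ×ˢ Ioo 0 1) (glue N ρ W) (glueDeriv N ρ W') := by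
  -- for every compact `K₀ ⊆ Ω₀`, replace `ρ` by globally smooth functions equal to it near `K₀`
  have key : ∀ K₀ ⊆ Ω₀, IsCompact K₀ → IntegrableOn (glue N ρ W) (K₀ ×ˢ univ) ∧
      IntegrableOn (glueDeriv N ρ W') (K₀ ×ˢ univ) ∧
      ∀ ψ : E × ℝ → ℝ, ContDiff ℝ ∞ ψ → HasCompactSupport ψ → tsupport ψ ⊆ K₀ ×ˢ Ioo 0 1 →
        ∀ v, ∫ z, fderiv ℝ ψ z v • glue N ρ W z = - ∫ z, ψ z • glueDeriv N ρ W' z v := by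
    intro K₀ hK₀Ω hK₀
    obtain ⟨L, hLc, hKL, hLΩ⟩ := exists_compact_between hK₀ hΩ₀ hK₀Ω
    obtain ⟨χ, hχ1, hχ0, hχ⟩ := exists_contMDiffMap_one_nhds_of_subset_interior (n := ⊤)
      (modelWithCornersSelf ℝ E) hK₀.isClosed hKL
    have hχs : ContDiff ℝ ∞ χ := χ.contMDiff.contDiff
    have hχ1' : ∀ y ∈ K₀, ∀ᶠ x in 𝓝 y, χ x = 1 := fun y hy =>
      hχ1.filter_mono (nhds_le_nhdsSet hy)
    let ρ' : ℕ → E → ℝ := fun k y => χ y * ρ k y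
    have hρ' : ∀ k, ContDiff ℝ ∞ (ρ' k) := by
      intro k
      refine contDiff_iff_contDiffAt.2 fun y => ?_
      by_cases hy : y ∈ Ω₀
      · exact hχs.contDiffAt.mul ((hρ k).contDiffAt (hΩ₀.mem_nhds hy))
      · have : ρ' k =ᶠ[𝓝 y] fun _ => 0 := by
          filter_upwards [hLc.isClosed.isOpen_compl.mem_nhds fun h => hy (hLΩ h)] with x hx
          simp [ρ', hχ0 x hx]
        exact contDiffAt_const.congr_of_eventuallyEq this
    have heq : ∀ k, ∀ y ∈ K₀, ρ k =ᶠ[𝓝 y] ρ' k := by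
      intro k y hy
      filter_upwards [hχ1' y hy] with x hx
      simp [ρ', hx]
    have h0' : ∀ k y, 0 ≤ ρ' k y := fun k y => mul_nonneg (hχ y).1 (h0 k y)
    have h1' : ∀ y ∈ K₀, ∑ k ∈ Finset.range N, ρ' k y = 1 := fun y hy => by
      rw [← h1 y (hK₀Ω hy)]
      exact Finset.sum_congr rfl fun k _ => ((heq k y hy).eq_of_nhds).symm
    choose! K hKext hKΩ hKρ using hW K₀ hK₀Ω hK₀
    have hρ1 : ∀ k < N, ∀ y ∈ K k, ρ' k y ≤ 1 := by
      intro k hk y hy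
      have : ρ k y ≤ 1 := by
        rw [← h1 y (hKΩ k hk hy)]
        exact Finset.single_le_sum (fun i _ => h0 i y) (Finset.mem_range.2 hk)
      exact mul_le_one₀ (hχ y).2 (h0 k y) this
    have hKρ' : ∀ k < N, ∀ y ∈ K₀, 0 < ρ' k y → y ∈ K k := fun k hk y hy h =>
      hKρ k hk y hy (by rwa [(heq k y hy).eq_of_nhds])
    have hm' : ∀ k, Measurable (ρ' k) := fun k => (hρ' k).continuous.measurable
    have hKm : MeasurableSet (K₀ ×ˢ (univ : Set ℝ)) := hK₀.measurableSet.prod MeasurableSet.univ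
    have hg : ∀ z ∈ K₀ ×ˢ (univ : Set ℝ), glue N ρ' W z = glue N ρ W z := fun z hz =>
      glue_congr (fun k => ((heq k z.1 hz.1).eq_of_nhds).symm) W
    have hgd : ∀ z ∈ K₀ ×ˢ (univ : Set ℝ), glueDeriv N ρ' W' z = glueDeriv N ρ W' z := fun z hz =>
      glueDeriv_congr (fun k => (heq k z.1 hz.1).symm) W'
    refine ⟨?_, ?_, fun ψ hψ hψc hψK v => ?_⟩
    · exact (integrableOn_glue hm' hρ1 hKρ' fun k hk => (hKext k hk).integrableOn).congr_fun hg hKm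
    · exact (integrableOn_glueDeriv hρ' (fun k hk => (hKext k hk).isCompact) hρ1 hKρ'
        fun k hk => (hKext k hk).integrableOn_deriv).congr_fun hgd hKm
    · have := integral_glue hρ' h0' h1' hρ1 hKρ' hKext hψ hψc hψK v
      have hψ0 : ∀ z, z ∉ K₀ ×ˢ (univ : Set ℝ) → z ∉ tsupport ψ := fun z hz h =>
        hz ⟨(hψK h).1, mem_univ _⟩
      convert this using 2
      · ext z
        by_cases hz : z ∈ K₀ ×ˢ (univ : Set ℝ)
        · rw [hg z hz]
        · rw [show fderiv ℝ ψ z = 0 from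
            Function.notMem_support.1 fun h => hψ0 z hz (support_fderiv_subset ℝ h)]
          simp
      · refine integral_congr_ae (Eventually.of_forall fun z => ?_)
        by_cases hz : z ∈ K₀ ×ˢ (univ : Set ℝ)
        · simp only [hgd z hz]
        · simp only [image_eq_zero_of_notMem_tsupport (hψ0 z hz), zero_smul]
  have hopen : IsOpen (Ω₀ ×ˢ Ioo (0 : ℝ) 1) := hΩ₀.prod isOpen_Ioo
  have hproj : ∀ S ⊆ Ω₀ ×ˢ Ioo (0 : ℝ) 1, IsCompact S →
      Prod.fst '' S ⊆ Ω₀ ∧ IsCompact (Prod.fst '' S) ∧ S ⊆ (Prod.fst '' S) ×ˢ Ioo (0 : ℝ) 1 := by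
    intro S hS hSc
    refine ⟨?_, hSc.image continuous_fst, fun z hz => ⟨mem_image_of_mem _ hz, (hS hz).2⟩⟩
    rintro _ ⟨z, hz, rfl⟩
    exact (hS hz).1
  refine ⟨?_, ?_, fun ψ hψ hψc hψΩ v => ?_⟩
  · rw [locallyIntegrableOn_iff hopen.isLocallyClosed]
    intro S hS hSc
    obtain ⟨h1, h2, h3⟩ := hproj S hS hSc
    exact (key _ h1 h2).1.mono_set (h3.trans (prod_mono_right (subset_univ _)))
  · rw [locallyIntegrableOn_iff hopen.isLocallyClosed]
    intro S hS hSc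
    obtain ⟨h1, h2, h3⟩ := hproj S hS hSc
    exact (key _ h1 h2).2.1.mono_set (h3.trans (prod_mono_right (subset_univ _)))
  · obtain ⟨h1, h2, h3⟩ := hproj _ hψΩ hψc.isCompact
    have := (key _ h1 h2).2.2 ψ hψ hψc h3 v
    rw [setIntegral_eq_integral_of_forall_compl_eq_zero,
      setIntegral_eq_integral_of_forall_compl_eq_zero, this]
    · intro z hz
      rw [image_eq_zero_of_notMem_tsupport fun h => hz (hψΩ h), zero_smul]
    · intro z hz
      rw [show fderiv ℝ ψ z = 0 from
        Function.notMem_support.1 fun h => hz (hψΩ (support_fderiv_subset ℝ h))]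
      simp

end EuclideanGlue

/-! ### Differentials in charts -/

section Chart

variable {d : ℕ} {M : Type*} [TopologicalSpace M]
  [ChartedSpace (EuclideanSpace ℝ (Fin d)) M] [IsManifold (𝓡 d) ∞ M]

/-- The differential at `x` of a function on `M`, as a linear form on the tangent space. -/
def scalarDeriv (σ : M → ℝ) (x : M) : TangentSpace (𝓡 d) x →L[ℝ] ℝ := mfderiv (𝓡 d) 𝓘(ℝ, ℝ) σ x

lemma fderiv_comp_chart_symm {σ : M → ℝ} (hσ : ContMDiff (𝓡 d) 𝓘(ℝ, ℝ) ∞ σ) (x₀ : M)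
    {y : EuclideanSpace ℝ (Fin d)} (hy : y ∈ (chartAt (EuclideanSpace ℝ (Fin d)) x₀).target)
    (w : EuclideanSpace ℝ (Fin d)) :
    fderiv ℝ (σ ∘ (chartAt (EuclideanSpace ℝ (Fin d)) x₀).symm) y w =
      scalarDeriv σ ((chartAt (EuclideanSpace ℝ (Fin d)) x₀).symm y) (chartSymmDeriv x₀ y w) := by
  have : IsManifold (𝓡 d) 1 M := IsManifold.of_le (n := ∞) (by simp)
  rw [← mfderiv_eq_fderiv, mfderiv_comp (I' := 𝓡 d) y
    (hσ.mdifferentiableAt (by simp))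
    ((mdifferentiable_chart (I := 𝓡 d) x₀).mdifferentiableAt_symm hy)]
  rfl

lemma contDiffOn_comp_chart_symm {σ : M → ℝ} (hσ : ContMDiff (𝓡 d) 𝓘(ℝ, ℝ) ∞ σ) (x₀ : M) :
    ContDiffOn ℝ ∞ (σ ∘ (chartAt (EuclideanSpace ℝ (Fin d)) x₀).symm)
      (chartAt (EuclideanSpace ℝ (Fin d)) x₀).target :=
  (hσ.comp_contMDiffOn (contMDiffOn_chart_symm (I := 𝓡 d) (n := ∞))).contDiffOn

lemma chartSymmDeriv_injective (x₀ : M) {y : EuclideanSpace ℝ (Fin d)}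
    (hy : y ∈ (chartAt (EuclideanSpace ℝ (Fin d)) x₀).target) :
    Function.Injective (chartSymmDeriv x₀ y) := by
  have : IsManifold (𝓡 d) 1 M := IsManifold.of_le (n := ∞) (by simp)
  have h := (mdifferentiable_chart (I := 𝓡 d) x₀).comp_symm_deriv hy
  intro v w hvw
  have h1 := congrArg (fun L => L v) h
  have h2 := congrArg (fun L => L w) h
  have h3 : mfderiv (𝓡 d) (𝓡 d) (chartAt (EuclideanSpace ℝ (Fin d)) x₀).symm y v =
    mfderiv (𝓡 d) (𝓡 d) (chartAt (EuclideanSpace ℝ (Fin d)) x₀).symm y w := hvw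
  exact (h1.symm.trans (congrArg (mfderiv (𝓡 d) (𝓡 d)
    (chartAt (EuclideanSpace ℝ (Fin d)) x₀)
      ((chartAt (EuclideanSpace ℝ (Fin d)) x₀).symm y)) h3)).trans h2

lemma continuousOn_chartSymmDeriv (x₀ : M) (e : EuclideanSpace ℝ (Fin d)) :
    ContinuousOn (fun y => (⟨(chartAt (EuclideanSpace ℝ (Fin d)) x₀).symm y,
      chartSymmDeriv x₀ y e⟩ : TotalSpace (EuclideanSpace ℝ (Fin d))
        (fun x : M => TangentSpace (𝓡 d) x)))
      (chartAt (EuclideanSpace ℝ (Fin d)) x₀).target := by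
  have : IsManifold (𝓡 d) 1 M := IsManifold.of_le (n := ∞) (by simp)
  have ho := (chartAt (EuclideanSpace ℝ (Fin d)) x₀).open_target
  have h := (contMDiffOn_chart_symm (I := 𝓡 d) (n := 1) (x := x₀)).continuousOn_tangentMapWithin
    le_rfl ho.uniqueMDiffOn
  have hc : Continuous fun y : EuclideanSpace ℝ (Fin d) =>
      (tangentBundleModelSpaceHomeomorph (𝓡 d)).symm (y, e) :=
    (Homeomorph.continuous _).comp (continuous_id.prodMk continuous_const)
  refine (h.comp hc.continuousOn fun y hy => hy).congr fun y hy => ?_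
  exact (tangentMapWithin_eq_tangentMap (p := (tangentBundleModelSpaceHomeomorph (𝓡 d)).symm (y, e))
    (ho.uniqueMDiffOn y hy)
    ((mdifferentiable_chart (I := 𝓡 d) x₀).mdifferentiableAt_symm hy)).symm

variable [RiemannianBundle (fun x : M => TangentSpace (𝓡 d) x)]
    [IsContMDiffRiemannianBundle (𝓡 d) ∞ (EuclideanSpace ℝ (Fin d))
      (fun x : M => TangentSpace (𝓡 d) x)]

lemma isContinuousRiemannianBundle_tangentSpace :
    IsContinuousRiemannianBundle (EuclideanSpace ℝ (Fin d))
      (fun x : M => TangentSpace (𝓡 d) x) := by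
  obtain ⟨g, hg, h⟩ := IsContMDiffRiemannianBundle.exists_contMDiff (IB := 𝓡 d) (n := ∞)
    (F := EuclideanSpace ℝ (Fin d)) (E := fun x : M => TangentSpace (𝓡 d) x)
  exact ⟨g, hg.continuous, h⟩

lemma continuousOn_chart_metric (x₀ : M) (e e' : EuclideanSpace ℝ (Fin d)) :
    ContinuousOn (fun y => inner ℝ (chartSymmDeriv x₀ y e) (chartSymmDeriv x₀ y e'))
      (chartAt (EuclideanSpace ℝ (Fin d)) x₀).target := by
  have := isContinuousRiemannianBundle_tangentSpace (d := d) (M := M)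
  exact (continuousOn_chartSymmDeriv x₀ e).inner_bundle (continuousOn_chartSymmDeriv x₀ e')

lemma continuousOn_chartDensity (x₀ : M) :
    ContinuousOn (chartDensity x₀) (chartAt (EuclideanSpace ℝ (Fin d)) x₀).target := by
  unfold chartDensity
  refine Real.continuous_sqrt.comp_continuousOn ?_
  refine (continuous_id.matrix_det).comp_continuousOn ?_
  exact continuousOn_pi.2 fun i => continuousOn_pi.2 fun j => continuousOn_chart_metric x₀ _ _

lemma chartDensity_pos (x₀ : M) {y : EuclideanSpace ℝ (Fin d)}
    (hy : y ∈ (chartAt (EuclideanSpace ℝ (Fin d)) x₀).target) : 0 < chartDensity x₀ y := by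
  refine Real.sqrt_pos.2 ?_
  have hli : LinearIndependent ℝ fun i : Fin d =>
      chartSymmDeriv x₀ y (EuclideanSpace.single i 1) := by
    have h := (EuclideanSpace.basisFun (Fin d) ℝ).toBasis.linearIndependent
    have h' := h.map' (chartSymmDeriv x₀ y).toLinearMap
      (LinearMap.ker_eq_bot.2 (chartSymmDeriv_injective x₀ hy))
    have he : (fun i : Fin d => chartSymmDeriv x₀ y (EuclideanSpace.single i 1)) =
        (chartSymmDeriv x₀ y).toLinearMap ∘ (EuclideanSpace.basisFun (Fin d) ℝ).toBasis := by
      ext i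
      simp
    rw [he]
    exact h'
  exact (Matrix.posDef_gram_of_linearIndependent (𝕜 := ℝ) hli).det_pos

/-- On compact subsets of the chart, the differential of the inverse of the chart is bounded with
respect to the Riemannian metric. -/
lemma exists_norm_chartSymmDeriv_le (x₀ : M) {K : Set (EuclideanSpace ℝ (Fin d))}
    (hK : IsCompact K) (hKt : K ⊆ (chartAt (EuclideanSpace ℝ (Fin d)) x₀).target) :
    ∃ C, 0 ≤ C ∧ ∀ y ∈ K, ∀ w, ‖chartSymmDeriv x₀ y w‖ ≤ C * ‖w‖ := by
  have hb : ∀ i : Fin d, ∃ C, ∀ y ∈ K,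
      ‖chartSymmDeriv x₀ y (EuclideanSpace.single i 1)‖ ≤ C := by
    intro i
    obtain ⟨C, hC⟩ := hK.exists_bound_of_continuousOn
      ((continuousOn_chart_metric x₀ (EuclideanSpace.single i 1)
        (EuclideanSpace.single i 1)).mono hKt)
    refine ⟨√C, fun y hy => Real.le_sqrt_of_sq_le ?_⟩
    rw [← real_inner_self_eq_norm_sq]
    exact (le_abs_self _).trans (hC y hy)
  choose C hC using hb
  refine ⟨∑ i, |C i|, by positivity, fun y hy w => ?_⟩
  have hw : w = ∑ i, w i • EuclideanSpace.single i (1 : ℝ) := by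
    simpa using ((EuclideanSpace.basisFun (Fin d) ℝ).sum_repr w).symm
  calc ‖chartSymmDeriv x₀ y w‖
      = ‖∑ i, w i • chartSymmDeriv x₀ y (EuclideanSpace.single i 1)‖ := by
        conv_lhs => rw [hw, map_sum]
        simp only [map_smul]
    _ ≤ ∑ i, ‖w i • chartSymmDeriv x₀ y (EuclideanSpace.single i 1)‖ := norm_sum_le _ _
    _ ≤ ∑ i, |C i| * ‖w‖ := by
        refine Finset.sum_le_sum fun i _ => ?_
        rw [norm_smul, mul_comm]
        gcongr
        · exact (hC i y hy).trans (le_abs_self _)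
        · exact PiLp.norm_apply_le w i
    _ = (∑ i, |C i|) * ‖w‖ := by rw [Finset.sum_mul]

/-- A smooth function on a compact Riemannian manifold has bounded differential. -/
lemma exists_abs_scalarDeriv_le [CompactSpace M] {σ : M → ℝ} (hσ : ContMDiff (𝓡 d) 𝓘(ℝ, ℝ) ∞ σ) :
    ∃ C, 0 ≤ C ∧ ∀ (x : M) (ξ : TangentSpace (𝓡 d) x),
      |scalarDeriv σ x ξ| ≤ C * ‖ξ‖ := by
  have : IsManifold (𝓡 d) 1 M := IsManifold.of_le (n := ∞) (by simp)
  have := isContinuousRiemannianBundle_tangentSpace (d := d) (M := M)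
  have hloc : ∀ x₀ : M, ∃ C, 0 ≤ C ∧ ∀ᶠ x in 𝓝 x₀, ∀ ξ : TangentSpace (𝓡 d) x,
      |scalarDeriv σ x ξ| ≤ C * ‖ξ‖ := by
    intro x₀
    obtain ⟨C, hC0, hC⟩ := eventually_norm_trivializationAt_lt (EuclideanSpace ℝ (Fin d))
      (fun x : M => TangentSpace (𝓡 d) x) x₀
    set φ := chartAt (EuclideanSpace ℝ (Fin d)) x₀ with hφ
    have hsm := contDiffOn_comp_chart_symm hσ x₀
    have hx₀ : x₀ ∈ φ.source := mem_chart_source _ x₀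
    have hcf : ContinuousAt (fun x => ‖fderiv ℝ (σ ∘ φ.symm) (φ x)‖) x₀ := by
      have h1 : ContinuousAt (fderiv ℝ (σ ∘ φ.symm)) (φ x₀) :=
        (hsm.continuousOn_fderiv_of_isOpen φ.open_target (by simp)).continuousAt
          (φ.open_target.mem_nhds (φ.map_source hx₀))
      exact (ContinuousAt.comp h1 (φ.continuousAt hx₀)).norm
    have hb := hcf.eventually_le_const (lt_add_one _)
    set B := ‖fderiv ℝ (σ ∘ φ.symm) (φ x₀)‖ + 1 with hB
    refine ⟨B * C, by positivity, ?_⟩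
    filter_upwards [hC, hb, φ.open_source.mem_nhds hx₀] with x hx hx' hxs ξ
    have hchain : scalarDeriv σ x ξ = fderiv ℝ (σ ∘ φ.symm) (φ x)
        ((trivializationAt (EuclideanSpace ℝ (Fin d)) (fun x : M => TangentSpace (𝓡 d) x)
          x₀).continuousLinearMapAt ℝ x ξ) := by
      rw [TangentBundle.continuousLinearMapAt_trivializationAt hxs]
      have hd : DifferentiableAt ℝ (σ ∘ φ.symm) (φ x) :=
        (hsm.contDiffAt (φ.open_target.mem_nhds (φ.map_source hxs))).differentiableAt (by simp)
      have hmφ : MDifferentiableAt (𝓡 d) (𝓡 d) φ x :=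
        (mdifferentiable_chart (I := 𝓡 d) x₀).mdifferentiableAt hxs
      have heq : σ =ᶠ[𝓝 x] (σ ∘ φ.symm) ∘ φ := by
        filter_upwards [φ.open_source.mem_nhds hxs] with z hz
        simp [φ.left_inv hz]
      have h1 : mfderiv (𝓡 d) 𝓘(ℝ, ℝ) σ x =
          (mfderiv (𝓡 d) 𝓘(ℝ, ℝ) (σ ∘ φ.symm) (φ x)).comp (mfderiv (𝓡 d) (𝓡 d) φ x) := by
        rw [heq.mfderiv_eq]
        exact mfderiv_comp (I' := 𝓡 d) x hd.mdifferentiableAt hmφ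
      rw [scalarDeriv, h1, mfderiv_eq_fderiv]
      rfl
    rw [hchain]
    refine ((fderiv ℝ (σ ∘ φ.symm) (φ x)).le_opNorm _).trans ?_
    rw [mul_assoc]
    gcongr
    exact (ContinuousLinearMap.le_opNorm _ _).trans (by gcongr)
  choose C hC0 hC using hloc
  obtain ⟨t, -, ht⟩ := isCompact_univ.elim_nhds_subcover
    (fun x₀ => {x | ∀ ξ : TangentSpace (𝓡 d) x,
      |scalarDeriv σ x ξ| ≤ C x₀ * ‖ξ‖}) fun x₀ _ => hC x₀
  refine ⟨∑ x₀ ∈ t, C x₀, Finset.sum_nonneg fun x₀ _ => hC0 x₀, fun x ξ => ?_⟩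
  obtain ⟨x₀, hx₀, hx⟩ := mem_iUnion₂.1 (ht (mem_univ x))
  refine (hx ξ).trans ?_
  gcongr
  exact Finset.single_le_sum (fun i _ => hC0 i) hx₀

end Chart

/-! ### The Hilbert–Schmidt norm -/

section DerivNorm

variable {d : ℕ} {M : Type*} [TopologicalSpace M]
  [ChartedSpace (EuclideanSpace ℝ (Fin d)) M] [IsManifold (𝓡 d) ∞ M]
  [RiemannianBundle (fun x : M => TangentSpace (𝓡 d) x)] {ν : ℕ}

instance finiteDimensional_tangentSpace (x : M) : FiniteDimensional ℝ (TangentSpace (𝓡 d) x) :=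
  inferInstanceAs (FiniteDimensional ℝ (EuclideanSpace ℝ (Fin d)))

lemma finrank_tangentSpace (x : M) : Module.finrank ℝ (TangentSpace (𝓡 d) x) = d :=
  (finrank_euclideanSpace_fin : Module.finrank ℝ (EuclideanSpace ℝ (Fin d)) = d)

lemma derivNorm_nonneg (x : M)
    (A : TangentSpace (𝓡 d) x × ℝ →L[ℝ] EuclideanSpace ℝ (Fin ν)) : 0 ≤ derivNorm x A :=
  Real.sqrt_nonneg _

lemma derivNorm_sq (x : M) (A : TangentSpace (𝓡 d) x × ℝ →L[ℝ] EuclideanSpace ℝ (Fin ν)) :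
    derivNorm x A ^ 2 =
      (∑ i, ‖A (stdOrthonormalBasis ℝ (TangentSpace (𝓡 d) x) i, 0)‖ ^ 2) + ‖A (0, 1)‖ ^ 2 := by
  rw [derivNorm, Real.sq_sqrt (by positivity)]

lemma norm_apply_vertical_le (x : M)
    (A : TangentSpace (𝓡 d) x × ℝ →L[ℝ] EuclideanSpace ℝ (Fin ν)) :
    ‖A (0, 1)‖ ≤ derivNorm x A := by
  refine Real.le_sqrt_of_sq_le ?_
  have : 0 ≤ ∑ i, ‖A (stdOrthonormalBasis ℝ (TangentSpace (𝓡 d) x) i, 0)‖ ^ 2 := by positivity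
  linarith

lemma norm_apply_horizontal_le (x : M)
    (A : TangentSpace (𝓡 d) x × ℝ →L[ℝ] EuclideanSpace ℝ (Fin ν)) (ξ : TangentSpace (𝓡 d) x) :
    ‖A (ξ, 0)‖ ≤ d * derivNorm x A * ‖ξ‖ := by
  let e := stdOrthonormalBasis ℝ (TangentSpace (𝓡 d) x)
  have he : ∀ i, ‖A (e i, 0)‖ ≤ derivNorm x A := by
    intro i
    refine Real.le_sqrt_of_sq_le ?_
    have h1 : ‖A (e i, 0)‖ ^ 2 ≤ ∑ i, ‖A (e i, 0)‖ ^ 2 :=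
      Finset.single_le_sum (f := fun i => ‖A (e i, 0)‖ ^ 2) (fun _ _ => by positivity)
        (Finset.mem_univ i)
    have h2 : 0 ≤ ‖A (0, 1)‖ ^ 2 := by positivity
    linarith
  have hsum : A (ξ, 0) = ∑ i, inner ℝ (e i) ξ • A (e i, 0) := by
    have h1 : ((ξ, 0) : TangentSpace (𝓡 d) x × ℝ) =
        ContinuousLinearMap.inl ℝ (TangentSpace (𝓡 d) x) ℝ ξ := rfl
    have h2 : ∀ i, ((e i, 0) : TangentSpace (𝓡 d) x × ℝ) =
        ContinuousLinearMap.inl ℝ (TangentSpace (𝓡 d) x) ℝ (e i) := fun _ => rfl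
    simp only [h2]
    rw [h1]
    conv_lhs => rw [← e.sum_repr' ξ, map_sum, map_sum]
    simp only [map_smul]
  rw [hsum]
  calc ‖∑ i, inner ℝ (e i) ξ • A (e i, 0)‖
      ≤ ∑ i, ‖inner ℝ (e i) ξ • A (e i, 0)‖ := norm_sum_le _ _
    _ ≤ ∑ _i : Fin (Module.finrank ℝ (TangentSpace (𝓡 d) x)), ‖ξ‖ * derivNorm x A := by
        refine Finset.sum_le_sum fun i _ => ?_
        rw [norm_smul]
        gcongr
        · refine (norm_inner_le_norm _ _).trans ?_
          rw [e.orthonormal.1 i, one_mul]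
        · exact he i
    _ = d * derivNorm x A * ‖ξ‖ := by
        rw [Finset.sum_const, Finset.card_univ, Fintype.card_fin, finrank_tangentSpace,
          nsmul_eq_mul]
        ring

/-- The differential of `(x, t) ↦ (x, c (t - s x))` changes the Hilbert–Schmidt norm at most by a
factor which depends on a bound for `ds`. -/
lemma derivNorm_comp_cellMap_le {Λ : ℝ} (x : M)
    (A : TangentSpace (𝓡 d) x × ℝ →L[ℝ] EuclideanSpace ℝ (Fin ν))
    (ℓ : TangentSpace (𝓡 d) x →L[ℝ] ℝ) (hℓ : ∀ ξ, |ℓ ξ| ≤ Λ * ‖ξ‖) {c : ℝ} (hc : c * c = 1) :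
    derivNorm x (A.comp (cellMap ℓ c)) ≤ √(2 * d * Λ ^ 2 + 2) * derivNorm x A := by
  let e := stdOrthonormalBasis ℝ (TangentSpace (𝓡 d) x)
  have hcabs : |c| = 1 := by
    rcases mul_self_eq_one_iff.1 hc with rfl | rfl <;> simp
  refine Real.sqrt_le_iff.2 ⟨mul_nonneg (Real.sqrt_nonneg _) (derivNorm_nonneg x A), ?_⟩
  rw [mul_pow, Real.sq_sqrt (by positivity), derivNorm_sq]
  have hsm : ∀ t : ℝ, ‖A (0, t)‖ = |t| * ‖A (0, 1)‖ := by
    intro t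
    have : ((0, t) : TangentSpace (𝓡 d) x × ℝ) = t • (0, 1) := by ext <;> simp
    rw [this, map_smul, norm_smul, Real.norm_eq_abs]
  have hterm : ∀ i, ‖A.comp (cellMap ℓ c) (e i, 0)‖ ^ 2 ≤
      2 * ‖A (e i, 0)‖ ^ 2 + 2 * Λ ^ 2 * ‖A (0, 1)‖ ^ 2 := by
    intro i
    have h1 : A.comp (cellMap ℓ c) (e i, 0) = A (e i, 0) + A (0, c * (0 - ℓ (e i))) := by
      rw [← map_add]
      simp
    have h2 : |c * (0 - ℓ (e i))| ≤ Λ := by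
      rw [abs_mul, hcabs, one_mul, zero_sub, abs_neg]
      simpa [e.orthonormal.1 i] using hℓ (e i)
    have h3 : ‖A.comp (cellMap ℓ c) (e i, 0)‖ ≤ ‖A (e i, 0)‖ + Λ * ‖A (0, 1)‖ := by
      rw [h1]
      refine (norm_add_le _ _).trans ?_
      rw [hsm]
      gcongr
    have h4 := pow_le_pow_left₀ (norm_nonneg _) h3 2
    nlinarith [sq_nonneg (‖A (e i, 0)‖ - Λ * ‖A (0, 1)‖)]
  have hvert : ‖A.comp (cellMap ℓ c) (0, 1)‖ = ‖A (0, 1)‖ := by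
    have : A.comp (cellMap ℓ c) (0, 1) = A (0, c) := by simp
    rw [this, hsm, hcabs, one_mul]
  have hsum := Finset.sum_le_sum fun i (_ : i ∈ Finset.univ) => hterm i
  rw [Finset.sum_add_distrib, ← Finset.mul_sum, Finset.sum_const, Finset.card_univ,
    Fintype.card_fin, nsmul_eq_mul] at hsum
  have hn : (Module.finrank ℝ (TangentSpace (𝓡 d) x) : ℝ) = d := by
    exact_mod_cast finrank_tangentSpace x
  rw [hvert]
  have aux : ∀ {S a B n D : ℝ}, n = D → 0 ≤ D → 0 ≤ a → 0 ≤ B →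
      S ≤ 2 * a + n * (2 * Λ ^ 2 * B) → S + B ≤ (2 * D * Λ ^ 2 + 2) * (a + B) := by
    intro S a B n D hn hD ha hB h
    subst hn
    have : 0 ≤ 2 * n * Λ ^ 2 * a := by positivity
    linarith
  exact aux hn d.cast_nonneg (Finset.sum_nonneg fun i _ => sq_nonneg _) (sq_nonneg _) hsum

/-- A derivative read in a chart is bounded by its Hilbert–Schmidt norm. -/
lemma norm_comp_prodMap_le {C : ℝ} (hC : 0 ≤ C) (x : M)
    (A : TangentSpace (𝓡 d) x × ℝ →L[ℝ] EuclideanSpace ℝ (Fin ν))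
    (L : EuclideanSpace ℝ (Fin d) →L[ℝ] TangentSpace (𝓡 d) x) (hL : ∀ w, ‖L w‖ ≤ C * ‖w‖) :
    ‖A.comp (L.prodMap (ContinuousLinearMap.id ℝ ℝ))‖ ≤ (d * C + 1) * derivNorm x A := by
  have h0 := derivNorm_nonneg x A
  refine ContinuousLinearMap.opNorm_le_bound _ (by positivity) fun w => ?_
  have h1 : A.comp (L.prodMap (ContinuousLinearMap.id ℝ ℝ)) w = A (L w.1, 0) + w.2 • A (0, 1) := by
    rw [← map_smul, ← map_add]
    simp
    rfl
  rw [h1]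
  calc ‖A (L w.1, 0) + w.2 • A (0, 1)‖ ≤ ‖A (L w.1, 0)‖ + ‖w.2 • A (0, 1)‖ := norm_add_le _ _
    _ ≤ d * derivNorm x A * (C * ‖w‖) + ‖w‖ * derivNorm x A := by
        rw [norm_smul]
        gcongr
        · refine (norm_apply_horizontal_le x A _).trans ?_
          gcongr
          exact (hL w.1).trans (by gcongr; exact norm_fst_le w)
        · exact norm_snd_le w
        · exact norm_apply_vertical_le x A
    _ = (d * C + 1) * derivNorm x A * ‖w‖ := by ring

end DerivNorm

/-! ### The Riemannian volume in charts -/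

section Volume

variable {d : ℕ} {M : Type*} [TopologicalSpace M] [T2Space M]
  [ChartedSpace (EuclideanSpace ℝ (Fin d)) M] [IsManifold (𝓡 d) ∞ M]
  [RiemannianBundle (fun x : M => TangentSpace (𝓡 d) x)]
  [IsContMDiffRiemannianBundle (𝓡 d) ∞ (EuclideanSpace ℝ (Fin d))
      (fun x : M => TangentSpace (𝓡 d) x)]
  [MeasurableSpace M] [BorelSpace M]

/-- On compact subsets of the chart, the pushforward of the Lebesgue measure is bounded by the
Riemannian volume, because the volume density is bounded below. -/
lemma exists_smul_map_le_riemannianVolume (x₀ : M) {K : Set (EuclideanSpace ℝ (Fin d))}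
    (hK : IsCompact K) (hKt : K ⊆ (chartAt (EuclideanSpace ℝ (Fin d)) x₀).target) :
    ∃ c : ℝ, 0 < c ∧ ENNReal.ofReal c •
      ((volume.restrict K).map (chartAt (EuclideanSpace ℝ (Fin d)) x₀).symm) ≤
        riemannianVolume d M := by
  set φ := chartAt (EuclideanSpace ℝ (Fin d)) x₀
  obtain ⟨c, hc0, hc⟩ : ∃ c : ℝ, 0 < c ∧ ∀ y ∈ K, c ≤ chartDensity x₀ y := by
    rcases K.eq_empty_or_nonempty with rfl | hne
    · exact ⟨1, one_pos, by simp⟩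
    · obtain ⟨y, hy, hmin⟩ := hK.exists_isMinOn hne ((continuousOn_chartDensity x₀).mono hKt)
      exact ⟨chartDensity x₀ y, chartDensity_pos x₀ (hKt hy), fun z hz => hmin hz⟩
  refine ⟨c, hc0, le_trans ?_ (le_iSup _ x₀)⟩
  set ν : Measure (EuclideanSpace ℝ (Fin d)) := (volume.restrict φ.target).withDensity
      (fun y => ENNReal.ofReal (chartDensity x₀ y)) with hν
  have hle : ENNReal.ofReal c • volume.restrict K ≤ ν := by
    refine Measure.le_iff.2 fun s hs => ?_
    rw [hν, withDensity_apply _ hs, Measure.restrict_restrict hs, Measure.smul_apply, smul_eq_mul,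
      Measure.restrict_apply hs]
    calc ENNReal.ofReal c * volume (s ∩ K) = ∫⁻ _y in s ∩ K, ENNReal.ofReal c := by simp
      _ ≤ ∫⁻ y in s ∩ K, ENNReal.ofReal (chartDensity x₀ y) := by
          refine setLIntegral_mono' (hs.inter hK.measurableSet) fun y hy => ?_
          exact ENNReal.ofReal_le_ofReal (hc y hy.2)
      _ ≤ _ := lintegral_mono_set (inter_subset_inter_right s hKt)
  have hae : AEMeasurable φ.symm ν :=
    (φ.continuousOn_symm.aemeasurable φ.open_target.measurableSet).mono_ac
      (withDensity_absolutelyContinuous _ _)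
  rw [← Measure.map_smul]
  exact Measure.map_mono_of_aemeasurable hle hae

/-- Integrals in a chart, over compact subsets of the chart, are bounded by integrals for the
Riemannian volume of the collar. The function `f` is not assumed to be measurable. -/
lemma exists_lintegral_chart_le (x₀ : M) {K : Set (EuclideanSpace ℝ (Fin d))}
    (hK : IsCompact K) (hKt : K ⊆ (chartAt (EuclideanSpace ℝ (Fin d)) x₀).target) :
    ∃ C : ℝ≥0, ∀ (f : M × ℝ → ℝ≥0∞) (S : Set ℝ), MeasurableSet S →
      ∫⁻ z in K ×ˢ S, f ((chartAt (EuclideanSpace ℝ (Fin d)) x₀).symm z.1, z.2) ≤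
        C * ∫⁻ z in ((chartAt (EuclideanSpace ℝ (Fin d)) x₀).symm '' K) ×ˢ S, f z
          ∂(collarVolume d M) := by
  obtain ⟨c, hc0, hc⟩ := exists_smul_map_le_riemannianVolume x₀ hK hKt
  set φ := chartAt (EuclideanSpace ℝ (Fin d)) x₀
  have hKm := hK.measurableSet
  have : CompactSpace K := isCompact_iff_compactSpace.1 hK
  -- the inverse of the chart on `K`
  let ι : K → M := fun y => φ.symm y
  have hι : MeasurableEmbedding ι := by
    have hcont : Continuous ι := continuousOn_iff_continuous_domRestrict.1
      (φ.continuousOn_symm.mono hKt)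
    have hinj : Function.Injective ι := fun y z h =>
      Subtype.ext (φ.symm.injOn (hKt y.2) (hKt z.2) h)
    exact (hcont.isClosedEmbedding hinj).measurableEmbedding
  let lam : Measure K := Measure.comap Subtype.val (volume : Measure (EuclideanSpace ℝ (Fin d)))
  have hlam : lam.map Subtype.val = volume.restrict K := map_comap_subtype_coe hKm _
  have : IsFiniteMeasure lam := by
    refine ⟨?_⟩
    have h1 : lam univ = (lam.map Subtype.val) univ := by
      rw [Measure.map_apply measurable_subtype_coe MeasurableSet.univ, preimage_univ]
    rw [h1, hlam, Measure.restrict_apply_univ]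
    exact hK.measure_lt_top
  have hmap : (volume.restrict K).map φ.symm = lam.map ι := by
    rw [← hlam]
    refine AEMeasurable.map_map_of_aemeasurable ?_ measurable_subtype_coe.aemeasurable
    rw [hlam]
    exact (φ.continuousOn_symm.mono hKt).aemeasurable hKm
  have hall : ∀ f : M × ℝ → ℝ≥0∞,
      ∫⁻ z, f (φ.symm z.1, z.2) ∂((volume.restrict K).prod volume) ≤
        (ENNReal.ofReal c)⁻¹ * ∫⁻ z, f z ∂(collarVolume d M) := by
    intro f
    have e1 : ∫⁻ z, f (φ.symm z.1, z.2) ∂((volume.restrict K).prod volume) =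
        ∫⁻ z, f z ∂((lam.map ι).prod volume) := by
      have h1 : (volume.restrict K).prod (volume : Measure ℝ) =
          (lam.prod volume).map (Prod.map Subtype.val id) := by
        rw [← Measure.map_prod_map _ _ measurable_subtype_coe measurable_id, hlam,
          Measure.map_id]
      have h2 : (lam.map ι).prod (volume : Measure ℝ) = (lam.prod volume).map (Prod.map ι id) := by
        rw [← Measure.map_prod_map _ _ hι.measurable measurable_id, Measure.map_id]
      rw [h1, h2, ((MeasurableEmbedding.subtype_coe hKm).prodMap
        MeasurableEmbedding.id).lintegral_map, (hι.prodMap MeasurableEmbedding.id).lintegral_map]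
      rfl
    have e2 : ENNReal.ofReal c • ((lam.map ι).prod (volume : Measure ℝ)) ≤ collarVolume d M := by
      refine Measure.le_iff.2 fun s hs => ?_
      rw [collarVolume, Measure.smul_apply, Measure.prod_apply hs, Measure.prod_apply hs,
        smul_eq_mul, ← smul_eq_mul, ← lintegral_smul_measure]
      exact lintegral_mono' (hmap ▸ hc) le_rfl
    have e3 := lintegral_mono' e2 (le_refl f)
    rw [lintegral_smul_measure, smul_eq_mul] at e3
    rw [e1]
    calc ∫⁻ z, f z ∂((lam.map ι).prod volume)
        = (ENNReal.ofReal c)⁻¹ * (ENNReal.ofReal c * ∫⁻ z, f z ∂((lam.map ι).prod volume)) := by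
          rw [← mul_assoc, ENNReal.inv_mul_cancel (by simpa using hc0) ENNReal.ofReal_ne_top,
            one_mul]
      _ ≤ _ := by gcongr
  refine ⟨c⁻¹.toNNReal, fun f S hS => ?_⟩
  have hcinv : (c⁻¹.toNNReal : ℝ≥0∞) = (ENNReal.ofReal c)⁻¹ := by
    rw [← ENNReal.ofReal_inv_of_pos hc0, ENNReal.ofReal]
  have himg : MeasurableSet (φ.symm '' K) :=
    (hK.image_of_continuousOn (φ.continuousOn_symm.mono hKt)).isClosed.measurableSet
  have h := hall (((φ.symm '' K) ×ˢ S).indicator f)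
  rw [hcinv, ← lintegral_indicator (himg.prod hS)]
  refine le_trans ?_ h
  rw [Measure.volume_eq_prod, ← Measure.prod_restrict]
  have hmono : (volume.restrict K).prod (volume.restrict S) =
      ((volume.restrict K).prod volume).restrict (univ ×ˢ S) := by
    rw [← Measure.prod_restrict, Measure.restrict_univ]
  rw [hmono, ← lintegral_indicator (MeasurableSet.univ.prod hS)]
  have haeK : ∀ᵐ z ∂((volume.restrict K).prod (volume : Measure ℝ)), z.1 ∈ K :=
    Measure.quasiMeasurePreserving_fst.ae (ae_restrict_mem hKm)
  refine lintegral_mono_ae ?_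
  filter_upwards [haeK] with z hz
  by_cases hzS : z.2 ∈ S
  · rw [indicator_of_mem (show z ∈ univ ×ˢ S from ⟨mem_univ _, hzS⟩), indicator_of_mem]
    exact ⟨mem_image_of_mem _ hz, hzS⟩
  · rw [indicator_of_notMem fun h => hzS h.2]
    exact zero_le

end Volume

/-! ### Integrability up to the boundary -/

section Integrability

variable {E V : Type*} [NormedAddCommGroup E] [NormedSpace ℝ E] [MeasureSpace E] [BorelSpace E]
  [SecondCountableTopology E] [SFinite (volume : Measure E)]
  [IsFiniteMeasureOnCompacts (volume : Measure E)]
  [NormedAddCommGroup V] [NormedSpace ℝ V]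

/-- A locally integrable map with a trace in `L¹` is integrable up to the boundary, and its trace
is integrable. -/
lemma integrableOn_of_tendsto_trace {Ω K : Set E} (hK : IsCompact K) (hKΩ : K ⊆ Ω)
    {W : E × ℝ → V} (hW : LocallyIntegrableOn W (Ω ×ˢ Ioo 0 1)) {u : E → V}
    (hu : AEStronglyMeasurable u (volume.restrict K))
    (htr : Tendsto (fun ε : ℝ => (ENNReal.ofReal ε)⁻¹ *
      ∫⁻ z in K ×ˢ Ioo 0 ε, ‖W z - u z.1‖ₑ) (𝓝[>] 0) (𝓝 0)) :
    IntegrableOn u K ∧ IntegrableOn W (K ×ˢ Ioo 0 (1 / 2)) := by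
  have hev : ∀ᶠ ε : ℝ in 𝓝[>] 0, ε ∈ Ioo (0 : ℝ) (1 / 2) := Ioo_mem_nhdsGT (by norm_num)
  obtain ⟨ε, hlt, hε0, hε1⟩ := ((htr.eventually (gt_mem_nhds one_pos)).and hev).exists
  have hfin : ∫⁻ z in K ×ˢ Ioo 0 ε, ‖W z - u z.1‖ₑ < ⊤ := by
    refine lt_top_iff_ne_top.2 fun h => ?_
    rw [h, ENNReal.mul_top (by simp)] at hlt
    exact not_top_lt hlt
  have hprod : ∀ S : Set ℝ, (volume : Measure (E × ℝ)).restrict (K ×ˢ S) =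
      (volume.restrict K).prod (volume.restrict S) := fun S => by
    rw [Measure.volume_eq_prod, Measure.prod_restrict]
  have hD : IntegrableOn (fun z => W z - u z.1) (K ×ˢ Ioo 0 ε) := by
    refine ⟨(hW.aestronglyMeasurable.mono_measure (Measure.restrict_mono ?_ le_rfl)).sub ?_, hfin⟩
    · exact prod_mono hKΩ (Ioo_subset_Ioo_right (by linarith))
    · rw [hprod]
      exact hu.comp_fst
  have hWc : ∀ a b : ℝ, 0 < a → b < 1 → IntegrableOn W (K ×ˢ Icc a b) := fun a b ha hb =>
    hW.integrableOn_compact_subset (prod_mono hKΩ fun t ht =>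
      ⟨ha.trans_le ht.1, ht.2.trans_lt hb⟩) (hK.prod isCompact_Icc)
  have huK : IntegrableOn u K := by
    have h1 : IntegrableOn (fun z : E × ℝ => u z.1) (K ×ˢ Icc (ε / 4) (ε / 2)) := by
      have h2 := (hWc (ε / 4) (ε / 2) (by linarith) (by linarith)).sub (hD.mono_set
        (prod_mono_right (fun t ht => ⟨by linarith [ht.1], by linarith [ht.2]⟩)))
      refine h2.congr (Eventually.of_forall fun z => ?_)
      simp
    rw [IntegrableOn, hprod] at h1
    refine (Integrable.comp_fst_iff ?_).1 h1
    intro h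
    have := congrArg (fun μ : Measure ℝ => μ univ) h
    simp at this
    linarith
  refine ⟨huK, ?_⟩
  have h1 : IntegrableOn (fun z : E × ℝ => u z.1) (K ×ˢ Ioo 0 ε) := by
    rw [IntegrableOn, hprod]
    exact huK.comp_fst _
  have h2 : IntegrableOn W (K ×ˢ Ioo 0 ε) :=
    (hD.add h1).congr (Eventually.of_forall fun z => by simp)
  refine (h2.union (hWc (ε / 2) (1 / 2) (by linarith) (by norm_num))).mono_set ?_
  rintro z ⟨hz1, hz2⟩
  rcases lt_or_ge z.2 ε with h | h
  · exact Or.inl ⟨hz1, hz2.1, h⟩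
  · exact Or.inr ⟨hz1, by linarith, hz2.2.le⟩

lemma integrableOn_of_lintegral_rpow {Ω K : Set E} (hK : IsCompact K) (hKΩ : K ⊆ Ω) {Y : Type*}
    [NormedAddCommGroup Y] {W' : E × ℝ → Y}
    (hW' : LocallyIntegrableOn W' (Ω ×ˢ Ioo 0 1)) {g : E × ℝ → ℝ} (hg : ∀ z, 0 ≤ g z) {C p : ℝ}
    (hC : 0 ≤ C) (hp : 1 ≤ p) (hle : ∀ z ∈ K ×ˢ Ioo (0 : ℝ) 1, ‖W' z‖ ≤ C * g z)
    (hfin : ∫⁻ z in K ×ˢ Ioo 0 1, ENNReal.ofReal (g z ^ p) ≠ ⊤) :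
    IntegrableOn W' (K ×ˢ Ioo 0 1) := by
  refine ⟨hW'.aestronglyMeasurable.mono_measure
    (Measure.restrict_mono (prod_mono_left hKΩ) le_rfl), ?_⟩
  have hm : MeasurableSet (K ×ˢ Ioo (0 : ℝ) 1) := hK.measurableSet.prod measurableSet_Ioo
  have hvol : volume (K ×ˢ Ioo (0 : ℝ) 1) ≠ ⊤ :=
    ((measure_mono (prod_mono_right Ioo_subset_Icc_self)).trans_lt
      (hK.prod (isCompact_Icc (a := (0 : ℝ)) (b := 1))).measure_lt_top).ne
  have hpt : ∀ t : ℝ, 0 ≤ t → t ≤ 1 + t ^ p := by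
    intro t ht
    rcases le_total t 1 with h | h
    · linarith [Real.rpow_nonneg ht p]
    · linarith [Real.self_le_rpow_of_one_le h hp]
  calc ∫⁻ z in K ×ˢ Ioo 0 1, ‖W' z‖ₑ
      ≤ ∫⁻ z in K ×ˢ Ioo 0 1, ENNReal.ofReal C * (1 + ENNReal.ofReal (g z ^ p)) := by
        refine setLIntegral_mono' hm fun z hz => ?_
        have h2 := Real.rpow_nonneg (hg z) p
        rw [← ofReal_norm, ← ENNReal.ofReal_one, ← ENNReal.ofReal_add zero_le_one h2,
          ← ENNReal.ofReal_mul hC]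
        exact ENNReal.ofReal_le_ofReal ((hle z hz).trans (by gcongr; exact hpt _ (hg z)))
    _ = ENNReal.ofReal C * (volume (K ×ˢ Ioo (0 : ℝ) 1) +
          ∫⁻ z in K ×ˢ Ioo 0 1, ENNReal.ofReal (g z ^ p)) := by
        rw [lintegral_const_mul' _ _ ENNReal.ofReal_ne_top, lintegral_add_left measurable_const]
        simp
    _ < ⊤ := ENNReal.mul_lt_top ENNReal.ofReal_lt_top
        (ENNReal.add_lt_top.2 ⟨hvol.lt_top, hfin.lt_top⟩)

lemma IsWeakFDerivOn.congr_deriv [FiniteDimensional ℝ E] {Ω : Set (E × ℝ)} (hΩ : IsOpen Ω)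
    {f : E × ℝ → V}
    {f' g' : E × ℝ → E × ℝ →L[ℝ] V} (h : IsWeakFDerivOn Ω f f') (hfg : EqOn f' g' Ω) :
    IsWeakFDerivOn Ω f g' := by
  refine ⟨h.1, ?_, fun ψ h1 h2 h3 v => ?_⟩
  · rw [locallyIntegrableOn_iff hΩ.isLocallyClosed]
    intro S hS hSc
    exact (h.2.1.integrableOn_compact_subset hS hSc).congr_fun (hfg.mono hS) hSc.measurableSet
  · rw [h.2.2 ψ h1 h2 h3 v]
    congr 1
    refine setIntegral_congr_fun hΩ.measurableSet fun z hz => ?_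
    simp only [hfg hz]

end Integrability

/-! ### Integrals over the cells -/

section Cells

variable {X : Type*} [MeasurableSpace X]

/-- If on each half cell `f` is bounded by `g k` at the distance to the boundary, then its integral
is bounded by those of the `g k`. The functions are not assumed to be measurable. -/
lemma lintegral_le_two_mul_sum (μ : Measure X) {N : ℕ} {ρ : ℕ → X → ℝ}
    (hρ : ∀ k, Measurable (ρ k)) (h1 : ∀ x, ∑ i ∈ Finset.range N, ρ i x = 1)
    {f : X × ℝ → ℝ≥0∞} {g : ℕ → X × ℝ → ℝ≥0∞} {A : Set (X × ℝ)} (hAm : MeasurableSet A)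
    (hA : ∀ z ∈ A, z.2 ∈ Ioo (0 : ℝ) 1) {B : ℕ → Set (X × ℝ)} (hB : ∀ k, MeasurableSet (B k))
    (h : ∀ k < N, ∀ b, ∀ z ∈ halfCell ρ k b, z ∈ A →
      (z.1, depth ρ k b z) ∈ B k ∧ f z ≤ g k (z.1, depth ρ k b z)) :
    ∫⁻ z in A, f z ∂(μ.prod volume) ≤
      2 * ∑ k ∈ Finset.range N, ∫⁻ z in B k, g k z ∂(μ.prod volume) := by
  have hcell : ∀ k < N, ∀ b, ∫⁻ z in halfCell ρ k b ∩ A, f z ∂(μ.prod volume) ≤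
      ∫⁻ z in B k, g k z ∂(μ.prod volume) := by
    intro k hk b
    have hm := measurableSet_halfCell hρ k b
    calc ∫⁻ z in halfCell ρ k b ∩ A, f z ∂(μ.prod volume)
        ≤ ∫⁻ z in halfCell ρ k b ∩ A,
            (B k).indicator (g k) (z.1, depth ρ k b z) ∂(μ.prod volume) := by
          refine setLIntegral_mono' (hm.inter hAm) fun z hz => ?_
          rw [indicator_of_mem (h k hk b z hz.1 hz.2).1]
          exact (h k hk b z hz.1 hz.2).2
      _ ≤ ∫⁻ z in halfCell ρ k b,
            (B k).indicator (g k) (z.1, depth ρ k b z) ∂(μ.prod volume) :=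
          lintegral_mono_set inter_subset_left
      _ = ∫⁻ z in layer (ρ k), (B k).indicator (g k) z ∂(μ.prod volume) :=
          lintegral_halfCell μ hρ k b _
      _ ≤ ∫⁻ z, (B k).indicator (g k) z ∂(μ.prod volume) := setLIntegral_le_lintegral _ _
      _ = _ := lintegral_indicator (hB k) _
  refine (lintegral_le_sum_halfCell μ hρ h1 f hA).trans ?_
  rw [Finset.mul_sum]
  refine Finset.sum_le_sum fun k hk => ?_
  have hk := Finset.mem_range.1 hk
  rw [Fintype.sum_bool, two_mul]
  exact add_le_add (hcell k hk _) (hcell k hk _)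

end Cells

/-! ### Gluing on the manifold -/

section Collar

variable {d : ℕ} {M : Type*} [TopologicalSpace M] [T2Space M]
  [ChartedSpace (EuclideanSpace ℝ (Fin d)) M] [IsManifold (𝓡 d) ∞ M]
  [RiemannianBundle (fun x : M => TangentSpace (𝓡 d) x)]
  [IsContMDiffRiemannianBundle (𝓡 d) ∞ (EuclideanSpace ℝ (Fin d))
      (fun x : M => TangentSpace (𝓡 d) x)]
  [MeasurableSpace M] [BorelSpace M] {ν : ℕ}

/-- `U`, with weak derivative `DU`, is a competitor in the definition of the extension energy of
`u` on the collar of `G`. -/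
structure IsCompetitor (p : ℝ) (G : Set M) (u : M → EuclideanSpace ℝ (Fin ν))
    (U : M × ℝ → EuclideanSpace ℝ (Fin ν))
    (DU : ∀ z : M × ℝ, TangentSpace (𝓡 d) z.1 × ℝ →L[ℝ] EuclideanSpace ℝ (Fin ν)) : Prop where
  weak : IsWeakDerivOnCollar G U DU
  lintegral_ne_top :
    ∫⁻ z in G ×ˢ Ioo 0 1, ENNReal.ofReal (derivNorm z.1 (DU z) ^ p) ∂(collarVolume d M) ≠ ⊤
  trace : HasTrace d G U u

/-- A competitor, read in a chart, is an extension of `u` over each compact set. -/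
lemma IsCompetitor.isExtensionOver {p : ℝ} (hp : 1 ≤ p) {G : Set M} (hG : IsOpen G)
    {u : M → EuclideanSpace ℝ (Fin ν)} (hu : Measurable u)
    {U : M × ℝ → EuclideanSpace ℝ (Fin ν)}
    {DU : ∀ z : M × ℝ, TangentSpace (𝓡 d) z.1 × ℝ →L[ℝ] EuclideanSpace ℝ (Fin ν)}
    (h : IsCompetitor p G u U DU) (x₀ : M) {K : Set (EuclideanSpace ℝ (Fin d))}
    (hK : IsCompact K) (hKG : K ⊆ (chartAt (EuclideanSpace ℝ (Fin d)) x₀).target ∩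
      (chartAt (EuclideanSpace ℝ (Fin d)) x₀).symm ⁻¹' G) :
    IsExtensionOver ((chartAt (EuclideanSpace ℝ (Fin d)) x₀).target ∩
      (chartAt (EuclideanSpace ℝ (Fin d)) x₀).symm ⁻¹' G) K
      (fun z => U ((chartAt (EuclideanSpace ℝ (Fin d)) x₀).symm z.1, z.2))
      (fun z => (DU ((chartAt (EuclideanSpace ℝ (Fin d)) x₀).symm z.1, z.2)).comp
        ((chartSymmDeriv x₀ z.1).prodMap (ContinuousLinearMap.id ℝ ℝ)))
      (fun y => u ((chartAt (EuclideanSpace ℝ (Fin d)) x₀).symm y)) := by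
  have hw := h.weak x₀
  rw [chartCollar] at hw
  set φ := chartAt (EuclideanSpace ℝ (Fin d)) x₀ with hφ
  have hKt : K ⊆ φ.target := hKG.trans inter_subset_left
  have hcont : ContinuousOn φ.symm K := φ.continuousOn_symm.mono hKt
  have hKi : IsCompact (φ.symm '' K) := hK.image_of_continuousOn hcont
  have hKiG : φ.symm '' K ⊆ G := image_subset_iff.2 (hKG.trans inter_subset_right)
  obtain ⟨C, hC⟩ := exists_lintegral_chart_le x₀ hK hKt
  have htr : Tendsto (fun ε : ℝ => (ENNReal.ofReal ε)⁻¹ *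
      ∫⁻ z in K ×ˢ Ioo 0 ε, ‖U (φ.symm z.1, z.2) - u (φ.symm z.1)‖ₑ) (𝓝[>] 0) (𝓝 0) := by
    have h1 := ENNReal.Tendsto.const_mul (a := (C : ℝ≥0∞)) (h.trace _ hKiG hKi)
      (Or.inr ENNReal.coe_ne_top)
    rw [mul_zero] at h1
    refine tendsto_of_tendsto_of_tendsto_of_le_of_le tendsto_const_nhds h1
      (fun _ => zero_le) fun ε => ?_
    calc _ ≤ (ENNReal.ofReal ε)⁻¹ * (C * _) := by
          gcongr
          exact hC (fun z => ‖U z - u z.1‖ₑ) (Ioo 0 ε) measurableSet_Ioo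
      _ = _ := by rw [← mul_assoc, mul_comm _ (C : ℝ≥0∞), mul_assoc]
  have hum : AEStronglyMeasurable (fun y => u (φ.symm y)) (volume.restrict K) :=
    (hu.comp_aemeasurable (hcont.aemeasurable hK.measurableSet)).aestronglyMeasurable
  obtain ⟨h1, h2⟩ := integrableOn_of_tendsto_trace hK hKG hw.1 hum htr
  obtain ⟨B, hB0, hB⟩ := exists_norm_chartSymmDeriv_le x₀ hK hKt
  refine ⟨φ.isOpen_inter_preimage_symm hG, hK, hKG, hw, h2, ?_, h1, htr⟩
  have h3 := integrableOn_of_lintegral_rpow hK hKG hw.2.1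
    (g := fun z => derivNorm (φ.symm z.1) (DU (φ.symm z.1, z.2)))
    (fun z => derivNorm_nonneg _ _) (C := d * B + 1) (by positivity) hp
    (fun z hz => norm_comp_prodMap_le hB0 _ _ _ (hB z.1 hz.1)) ?_
  · exact h3.mono_set (prod_mono_right (Ioo_subset_Ioo_right (by norm_num)))
  · refine ne_top_of_le_ne_top ?_ (hC (fun z => ENNReal.ofReal (derivNorm z.1 (DU z) ^ p))
      (Ioo 0 1) measurableSet_Ioo)
    refine ENNReal.mul_ne_top ENNReal.coe_ne_top (ne_top_of_le_ne_top h.lintegral_ne_top ?_)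
    exact lintegral_mono_set (prod_mono_left hKiG)

open Classical in
/-- The derivative of `glue N ρ U` on the collar, given the derivatives `DU` of the `U`. -/
def collarDeriv (N : ℕ) (ρ : ℕ → M → ℝ)
    (DU : ℕ → ∀ z : M × ℝ, TangentSpace (𝓡 d) z.1 × ℝ →L[ℝ] EuclideanSpace ℝ (Fin ν))
    (z : M × ℝ) : TangentSpace (𝓡 d) z.1 × ℝ →L[ℝ] EuclideanSpace ℝ (Fin ν) :=
  ∑ k ∈ Finset.range N, ∑ b : Bool, if z ∈ halfCell ρ k b then
    (DU k (z.1, depth ρ k b z)).comp (cellMap (scalarDeriv (base ρ k b) z.1) (orient b)) else 0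

lemma collarDeriv_eq_of_mem {N : ℕ} {ρ : ℕ → M → ℝ} {z : M × ℝ} (h0 : ∀ k, 0 ≤ ρ k z.1) {k : ℕ}
    (hk : k < N) {b : Bool} (hz : z ∈ halfCell ρ k b)
    (DU : ℕ → ∀ z : M × ℝ, TangentSpace (𝓡 d) z.1 × ℝ →L[ℝ] EuclideanSpace ℝ (Fin ν)) :
    collarDeriv N ρ DU z =
      (DU k (z.1, depth ρ k b z)).comp (cellMap (scalarDeriv (base ρ k b) z.1) (orient b)) := by
  classical
  rw [collarDeriv, sum_eq_of_mem_halfCell h0 hk hz _ fun l b' h => if_neg h, if_pos hz]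

lemma contMDiff_base {ρ : ℕ → M → ℝ} (hρ : ∀ k, ContMDiff (𝓡 d) 𝓘(ℝ, ℝ) ∞ (ρ k)) (k : ℕ)
    (b : Bool) : ContMDiff (𝓡 d) 𝓘(ℝ, ℝ) ∞ (base ρ k b) :=
  contMDiff_finsetSum fun i _ => hρ i

/-- In a chart, `collarDeriv` is `glueDeriv`. -/
lemma collarDeriv_comp_chart {N : ℕ} {ρ : ℕ → M → ℝ}
    (hρ : ∀ k, ContMDiff (𝓡 d) 𝓘(ℝ, ℝ) ∞ (ρ k))
    (DU : ℕ → ∀ z : M × ℝ, TangentSpace (𝓡 d) z.1 × ℝ →L[ℝ] EuclideanSpace ℝ (Fin ν)) (x₀ : M)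
    {z : EuclideanSpace ℝ (Fin d) × ℝ}
    (hz : z.1 ∈ (chartAt (EuclideanSpace ℝ (Fin d)) x₀).target) :
    glueDeriv N (fun k => ρ k ∘ (chartAt (EuclideanSpace ℝ (Fin d)) x₀).symm)
      (fun k z => (DU k ((chartAt (EuclideanSpace ℝ (Fin d)) x₀).symm z.1, z.2)).comp
        ((chartSymmDeriv x₀ z.1).prodMap (ContinuousLinearMap.id ℝ ℝ))) z =
    (collarDeriv N ρ DU ((chartAt (EuclideanSpace ℝ (Fin d)) x₀).symm z.1, z.2)).comp
        ((chartSymmDeriv x₀ z.1).prodMap (ContinuousLinearMap.id ℝ ℝ)) := by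
  classical
  refine ContinuousLinearMap.ext fun v => ?_
  simp only [glueDeriv, collarDeriv, ContinuousLinearMap.comp_apply, sum_apply]
  refine Finset.sum_congr rfl fun k _ => Finset.sum_congr rfl fun b _ => ?_
  set φ := chartAt (EuclideanSpace ℝ (Fin d)) x₀ with hφ
  by_cases hm : z ∈ halfCell (fun k => ρ k ∘ φ.symm) k b
  · have hm' : (φ.symm z.1, z.2) ∈ halfCell ρ k b := hm
    rw [indicator_of_mem hm, if_pos hm']
    have hb := fderiv_comp_chart_symm (contMDiff_base hρ k b) x₀ hz v.1
    have e1 : (chartSymmDeriv x₀ z.1).prodMap (ContinuousLinearMap.id ℝ ℝ)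
        (cellMap (fderiv ℝ (base (fun k => ρ k ∘ φ.symm) k b) z.1) (orient b) v) =
        cellMap (scalarDeriv (base ρ k b) (φ.symm z.1)) (orient b)
          ((chartSymmDeriv x₀ z.1).prodMap (ContinuousLinearMap.id ℝ ℝ) v) := by
      refine Prod.ext rfl ?_
      exact congrArg (fun r => orient b * (v.2 - r)) hb
    exact congrArg (DU k (φ.symm z.1, depth ρ k b (φ.symm z.1, z.2))) e1
  · have hm' : (φ.symm z.1, z.2) ∉ halfCell ρ k b := hm
    rw [indicator_of_notMem hm, if_neg hm']
    rfl

lemma isWeakDerivOnCollar_glue {p : ℝ} (hp : 1 ≤ p) {N : ℕ} {G : ℕ → Set M}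
    (hG : ∀ k, IsOpen (G k)) {ρ : ℕ → M → ℝ} (hρ : ∀ k, ContMDiff (𝓡 d) 𝓘(ℝ, ℝ) ∞ (ρ k))
    (h0 : ∀ k x, 0 ≤ ρ k x) (h1 : ∀ x, ∑ k ∈ Finset.range N, ρ k x = 1)
    (hρG : ∀ k, tsupport (ρ k) ⊆ G k) {u : M → EuclideanSpace ℝ (Fin ν)} (hu : Measurable u)
    {U : ℕ → M × ℝ → EuclideanSpace ℝ (Fin ν)}
    {DU : ℕ → ∀ z : M × ℝ, TangentSpace (𝓡 d) z.1 × ℝ →L[ℝ] EuclideanSpace ℝ (Fin ν)}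
    (h : ∀ k < N, IsCompetitor p (G k) u (U k) (DU k)) :
    IsWeakDerivOnCollar univ (glue N ρ U) (collarDeriv N ρ DU) := by
  intro x₀
  have hcc : chartCollar x₀ (univ : Set M) =
      (chartAt (EuclideanSpace ℝ (Fin d)) x₀).target ×ˢ Ioo (0 : ℝ) 1 := by
    simp [chartCollar]
  rw [hcc]
  set φ := chartAt (EuclideanSpace ℝ (Fin d)) x₀ with hφ
  refine IsWeakFDerivOn.congr_deriv (φ.open_target.prod isOpen_Ioo) ?_
    fun z hz => collarDeriv_comp_chart hρ DU x₀ hz.1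
  refine isWeakFDerivOn_glue φ.open_target (fun k => contDiffOn_comp_chart_symm (hρ k) x₀)
    (fun k y => h0 k _) (fun y _ => h1 _)
    (Ω := fun k => φ.target ∩ φ.symm ⁻¹' G k)
    (W := fun k z => U k (φ.symm z.1, z.2)) (u := fun y => u (φ.symm y)) ?_
  intro K₀ hK₀ hK₀c k hk
  have hclosed : IsClosed (K₀ ∩ φ.symm ⁻¹' tsupport (ρ k)) :=
    (φ.continuousOn_symm.mono hK₀).preimage_isClosed_of_isClosed hK₀c.isClosed
      (isClosed_tsupport _)
  refine ⟨K₀ ∩ φ.symm ⁻¹' tsupport (ρ k), ?_, inter_subset_left.trans hK₀, ?_⟩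
  · exact (h k hk).isExtensionOver hp (hG k) hu x₀
      (hK₀c.of_isClosed_subset hclosed inter_subset_left)
      (inter_subset_inter hK₀ (preimage_mono (hρG k)))
  · exact fun y hy hpos => ⟨hy, subset_tsupport _ (Function.mem_support.2 hpos.ne')⟩

variable [CompactSpace M]

lemma hasTrace_glue {N : ℕ} {G : ℕ → Set M} {ρ : ℕ → M → ℝ} (hρ : ∀ k, Continuous (ρ k))
    (h0 : ∀ k x, 0 ≤ ρ k x) (h1 : ∀ x, ∑ k ∈ Finset.range N, ρ k x = 1)
    (hρG : ∀ k, tsupport (ρ k) ⊆ G k) {u : M → EuclideanSpace ℝ (Fin ν)}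
    {U : ℕ → M × ℝ → EuclideanSpace ℝ (Fin ν)}
    (h : ∀ k < N, HasTrace d (G k) (U k) u) : HasTrace d univ (glue N ρ U) u := by
  intro K _ hK
  have hlim : Tendsto (fun ε : ℝ => 2 * ∑ k ∈ Finset.range N, (ENNReal.ofReal ε)⁻¹ *
      ∫⁻ z in tsupport (ρ k) ×ˢ Ioo 0 ε, ‖U k z - u z.1‖ₑ ∂(collarVolume d M))
      (𝓝[>] 0) (𝓝 0) := by
    have h2 := ENNReal.Tendsto.const_mul (a := 2) (tendsto_finsetSum (Finset.range N)
      fun k hk => h k (Finset.mem_range.1 hk) _ (hρG k) (isClosed_tsupport _).isCompact)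
      (Or.inr (by simp))
    simpa using h2
  refine tendsto_of_tendsto_of_tendsto_of_le_of_le' tendsto_const_nhds hlim
    (Eventually.of_forall fun _ => zero_le) ?_
  filter_upwards [Ioo_mem_nhdsGT (one_pos : (0 : ℝ) < 1)] with ε hε
  rw [← Finset.mul_sum, mul_left_comm]
  gcongr
  refine lintegral_le_two_mul_sum _ (fun k => (hρ k).measurable) h1
    (g := fun k z => ‖U k z - u z.1‖ₑ) (hK.measurableSet.prod measurableSet_Ioo)
    (fun z hz => ⟨hz.2.1, hz.2.2.trans hε.2⟩)
    (fun k => (isClosed_tsupport _).measurableSet.prod measurableSet_Ioo) ?_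
  intro k hk b z hz hzA
  have hpos : 0 < ρ k z.1 := by linarith [hz.1, hz.2]
  refine ⟨⟨subset_tsupport _ (Function.mem_support.2 hpos.ne'), hz.1,
    (depth_le_of_mem_halfCell (fun k => h0 k _) hz).trans_lt hzA.2.2⟩, ?_⟩
  rw [glue_eq_of_mem (fun k => h0 k _) hk hz]

/-- The energy of the glued map is bounded by the energies of its pieces: the pieces are transported
by measure preserving shears, which leave the penalisation unchanged and distort the derivatives by
a bounded factor. -/
lemma lintegral_glue_le {p Λ : ℝ} (hp : 1 ≤ p) {N : ℕ} {G : ℕ → Set M} (hG : ∀ k, IsOpen (G k))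
    {ρ : ℕ → M → ℝ} (hρ : ∀ k, Continuous (ρ k))
    (h0 : ∀ k x, 0 ≤ ρ k x) (h1 : ∀ x, ∑ k ∈ Finset.range N, ρ k x = 1)
    (hρG : ∀ k, tsupport (ρ k) ⊆ G k)
    (hΛ : ∀ k < N, ∀ (b : Bool) (x : M) (ξ : TangentSpace (𝓡 d) x),
      |scalarDeriv (base ρ k b) x ξ| ≤ Λ * ‖ξ‖)
    (F : EuclideanSpace ℝ (Fin ν) → ℝ≥0∞) (U : ℕ → M × ℝ → EuclideanSpace ℝ (Fin ν))
    (DU : ℕ → ∀ z : M × ℝ, TangentSpace (𝓡 d) z.1 × ℝ →L[ℝ] EuclideanSpace ℝ (Fin ν)) :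
    ∫⁻ z in univ ×ˢ Ioo 0 1, (ENNReal.ofReal (derivNorm z.1 (collarDeriv N ρ DU z) ^ p) +
      F (glue N ρ U z)) ∂(collarVolume d M) ≤
    2 * ∑ k ∈ Finset.range N, ENNReal.ofReal (√(2 * d * Λ ^ 2 + 2) ^ p) *
      ∫⁻ z in G k ×ˢ Ioo 0 1, (ENNReal.ofReal (derivNorm z.1 (DU k z) ^ p) + F (U k z))
        ∂(collarVolume d M) := by
  set A := √(2 * d * Λ ^ 2 + 2) with hA
  have hA1 : 1 ≤ A := by
    have : 0 ≤ 2 * (d : ℝ) * Λ ^ 2 := by positivity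
    exact Real.one_le_sqrt.2 (by linarith)
  have hAp : (1 : ℝ≥0∞) ≤ ENNReal.ofReal (A ^ p) := by
    rw [← ENNReal.ofReal_one]
    exact ENNReal.ofReal_le_ofReal (Real.one_le_rpow hA1 (by linarith))
  have hmul := fun k => lintegral_const_mul' (μ := (collarVolume d M).restrict (G k ×ˢ Ioo 0 1))
    (ENNReal.ofReal (A ^ p)) (fun z => ENNReal.ofReal (derivNorm z.1 (DU k z) ^ p) + F (U k z))
    ENNReal.ofReal_ne_top
  simp only [← hmul]
  refine lintegral_le_two_mul_sum _ (fun k => (hρ k).measurable) h1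
    (g := fun k z => ENNReal.ofReal (A ^ p) *
      (ENNReal.ofReal (derivNorm z.1 (DU k z) ^ p) + F (U k z)))
    (MeasurableSet.univ.prod measurableSet_Ioo) (fun z hz => hz.2)
    (fun k => (hG k).measurableSet.prod measurableSet_Ioo) ?_
  intro k hk b z hz hzA
  have hpos : 0 < ρ k z.1 := by linarith [hz.1, hz.2]
  refine ⟨⟨hρG k (subset_tsupport _ (Function.mem_support.2 hpos.ne')), hz.1,
    (depth_le_of_mem_halfCell (fun k => h0 k _) hz).trans_lt hzA.2.2⟩, ?_⟩
  rw [glue_eq_of_mem (fun k => h0 k _) hk hz, collarDeriv_eq_of_mem (fun k => h0 k _) hk hz,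
    mul_add]
  refine add_le_add ?_ (le_mul_of_one_le_left zero_le hAp)
  rw [← ENNReal.ofReal_mul (by positivity), ← Real.mul_rpow (by positivity) (derivNorm_nonneg _ _)]
  refine ENNReal.ofReal_le_ofReal (Real.rpow_le_rpow (derivNorm_nonneg _ _) ?_ (by linarith))
  exact derivNorm_comp_cellMap_le z.1 _ _ (hΛ k hk b z.1) (orient_mul_self b)

end Collar

/-! ### Comparison of the energies -/

section Energy

variable {d : ℕ} {M : Type*} [TopologicalSpace M] [T2Space M] [CompactSpace M]
  [ChartedSpace (EuclideanSpace ℝ (Fin d)) M] [IsManifold (𝓡 d) ∞ M]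
  [RiemannianBundle (fun x : M => TangentSpace (𝓡 d) x)]
  [IsContMDiffRiemannianBundle (𝓡 d) ∞ (EuclideanSpace ℝ (Fin d))
      (fun x : M => TangentSpace (𝓡 d) x)]
  [MeasurableSpace M] [BorelSpace M]

lemma extEnergy_le {ν : ℕ} {p : ℝ} {F : EuclideanSpace ℝ (Fin ν) → ℝ≥0∞}
    {u : M → EuclideanSpace ℝ (Fin ν)} {G : Set M} {U : M × ℝ → EuclideanSpace ℝ (Fin ν)}
    {DU : ∀ z : M × ℝ, TangentSpace (𝓡 d) z.1 × ℝ →L[ℝ] EuclideanSpace ℝ (Fin ν)}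
    (h : IsCompetitor p G u U DU) :
    extEnergy d p F u G ≤ ∫⁻ z in G ×ˢ Ioo 0 1,
      (ENNReal.ofReal (derivNorm z.1 (DU z) ^ p) + F (U z)) ∂(collarVolume d M) :=
  iInf_le_of_le U <| iInf_le_of_le DU <| iInf_le_of_le h.weak <|
    iInf_le_of_le h.lintegral_ne_top <| iInf_le _ h.trace

lemma exists_isCompetitor_of_extEnergy_lt {ν : ℕ} {p : ℝ}
    {F : EuclideanSpace ℝ (Fin ν) → ℝ≥0∞} {u : M → EuclideanSpace ℝ (Fin ν)} {G : Set M}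
    {a : ℝ≥0∞} (h : extEnergy d p F u G < a) :
    ∃ (U : M × ℝ → EuclideanSpace ℝ (Fin ν))
      (DU : ∀ z : M × ℝ, TangentSpace (𝓡 d) z.1 × ℝ →L[ℝ] EuclideanSpace ℝ (Fin ν)),
      IsCompetitor p G u U DU ∧ ∫⁻ z in G ×ˢ Ioo 0 1,
        (ENNReal.ofReal (derivNorm z.1 (DU z) ^ p) + F (U z)) ∂(collarVolume d M) < a := by
  simp only [extEnergy, iInf_lt_iff] at h
  obtain ⟨U, DU, h1, h2, h3, h4⟩ := h
  exact ⟨U, DU, ⟨h1, h2, h3⟩, h4⟩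

/-- The comparison of the energies, for a covering with a given subordinate smooth partition of
unity. The constant depends on `d`, `p` and a bound for the differentials of the partial sums. -/
theorem exists_extEnergy_univ_le {p : ℝ} (hp : 1 ≤ p) {N : ℕ} {G : ℕ → Set M}
    (hG : ∀ k, IsOpen (G k)) {ρ : ℕ → M → ℝ} (hρ : ∀ k, ContMDiff (𝓡 d) 𝓘(ℝ, ℝ) ∞ (ρ k))
    (h0 : ∀ k x, 0 ≤ ρ k x) (h1 : ∀ x, ∑ k ∈ Finset.range N, ρ k x = 1)
    (hρG : ∀ k, tsupport (ρ k) ⊆ G k) :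
    ∃ C : ℝ≥0, ∀ (ν : ℕ) (F : EuclideanSpace ℝ (Fin ν) → ℝ≥0∞)
      (u : M → EuclideanSpace ℝ (Fin ν)), Measurable u →
      extEnergy d p F u univ ≤ C * ∑ k ∈ Finset.range N, extEnergy d p F u (G k) := by
  have hρc : ∀ k, Continuous (ρ k) := fun k => (hρ k).continuous
  choose B hB0 hB using fun k b => exists_abs_scalarDeriv_le (contMDiff_base hρ k b)
  let Λ : ℝ := ∑ k ∈ Finset.range N, ∑ b : Bool, B k b
  have hΛ : ∀ k < N, ∀ (b : Bool) (x : M) (ξ : TangentSpace (𝓡 d) x),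
      |scalarDeriv (base ρ k b) x ξ| ≤ Λ * ‖ξ‖ := by
    intro k hk b x ξ
    refine (hB k b x ξ).trans ?_
    gcongr
    refine (Finset.single_le_sum (f := B k) (fun b _ => hB0 k b) (Finset.mem_univ b)).trans ?_
    exact Finset.single_le_sum (f := fun k => ∑ b : Bool, B k b)
      (fun k _ => Finset.sum_nonneg fun b _ => hB0 k b) (Finset.mem_range.2 hk)
  let A : ℝ := √(2 * d * Λ ^ 2 + 2) ^ p
  have hA : 0 < A := Real.rpow_pos_of_pos (Real.sqrt_pos.2 (by positivity)) p
  refine ⟨2 * A.toNNReal, fun ν F u hu => ?_⟩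
  -- every choice of competitors on the `G k` yields an upper bound
  have hglue : ∀ (U : ℕ → M × ℝ → EuclideanSpace ℝ (Fin ν))
      (DU : ℕ → ∀ z : M × ℝ, TangentSpace (𝓡 d) z.1 × ℝ →L[ℝ] EuclideanSpace ℝ (Fin ν)),
      (∀ k < N, IsCompetitor p (G k) u (U k) (DU k)) →
      extEnergy d p F u univ ≤ (2 * A.toNNReal : ℝ≥0) * ∑ k ∈ Finset.range N,
        ∫⁻ z in G k ×ˢ Ioo 0 1, (ENNReal.ofReal (derivNorm z.1 (DU k z) ^ p) + F (U k z))
          ∂(collarVolume d M) := by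
    intro U DU h
    have hle := fun F => lintegral_glue_le hp hG hρc h0 h1 hρG hΛ F U DU
    have hcomp : IsCompetitor p univ u (glue N ρ U) (collarDeriv N ρ DU) := by
      refine ⟨isWeakDerivOnCollar_glue hp hG hρ h0 h1 hρG hu h, ?_,
        hasTrace_glue hρc h0 h1 hρG fun k hk => (h k hk).trace⟩
      have := hle fun _ => 0
      simp only [add_zero] at this
      refine ne_top_of_le_ne_top (ENNReal.mul_ne_top (by simp) ?_) this
      exact ENNReal.sum_ne_top.2 fun k hk => ENNReal.mul_ne_top ENNReal.ofReal_ne_top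
        (h k (Finset.mem_range.1 hk)).lintegral_ne_top
    refine (extEnergy_le hcomp).trans ((hle F).trans_eq ?_)
    rw [← Finset.mul_sum, ← mul_assoc]
    rfl
  refine ENNReal.le_of_forall_pos_le_add fun ε hε hfin => ?_
  have hlt : ∀ k < N, extEnergy d p F u (G k) < ⊤ := by
    intro k hk
    have hC : ((2 * A.toNNReal : ℝ≥0) : ℝ≥0∞) ≠ 0 := by
      simpa using hA
    have := ENNReal.lt_top_of_mul_ne_top_right hfin.ne hC
    exact ENNReal.sum_lt_top.1 this k (Finset.mem_range.2 hk)
  let δ : ℝ≥0 := ε / (2 * A.toNNReal * N + 1)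
  have hδ : 0 < δ := by positivity
  have hδε : 2 * A.toNNReal * (N * δ) ≤ ε := by
    have : (2 * A.toNNReal * N + 1) * δ = ε := mul_div_cancel₀ _ (by positivity)
    rw [← this, add_mul, ← mul_assoc]
    exact le_self_add
  have hex := fun k (hk : k < N) => exists_isCompetitor_of_extEnergy_lt
    (ENNReal.lt_add_right (hlt k hk).ne (ENNReal.coe_ne_zero.2 hδ.ne'))
  choose! U DU hU hlt' using hex
  calc extEnergy d p F u univ
      ≤ (2 * A.toNNReal : ℝ≥0) * ∑ k ∈ Finset.range N,
          ∫⁻ z in G k ×ˢ Ioo 0 1, (ENNReal.ofReal (derivNorm z.1 (DU k z) ^ p) + F (U k z))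
            ∂(collarVolume d M) := hglue U DU hU
    _ ≤ (2 * A.toNNReal : ℝ≥0) * ∑ k ∈ Finset.range N, (extEnergy d p F u (G k) + δ) := by
        gcongr with k hk
        exact (hlt' k (Finset.mem_range.1 hk)).le
    _ = (2 * A.toNNReal : ℝ≥0) * ∑ k ∈ Finset.range N, extEnergy d p F u (G k) +
          (2 * A.toNNReal * (N * δ) : ℝ≥0) := by
        rw [Finset.sum_add_distrib, mul_add, Finset.sum_const, Finset.card_range, nsmul_eq_mul]
        push_cast
        rfl
    _ ≤ _ := by
        gcongr

end Energy

end PenalisedExtension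

end

theorem theorem1p3 {d : ℕ} {M : Type*} [TopologicalSpace M] [T2Space M] [CompactSpace M]
    [ChartedSpace (EuclideanSpace ℝ (Fin d)) M] [IsManifold (𝓡 d) ∞ M]
    [RiemannianBundle (fun x : M => TangentSpace (𝓡 d) x)]
    [IsContMDiffRiemannianBundle (𝓡 d) ∞ (EuclideanSpace ℝ (Fin d))
      (fun x : M => TangentSpace (𝓡 d) x)]
    [MeasurableSpace M] [BorelSpace M]
    {ι : Type*} [Fintype ι] (G : ι → Set M) (hG : ∀ i, IsOpen (G i)) (hcov : ⋃ i, G i = univ)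
    (p : ℝ) (hp : 1 ≤ p) :
    ∃ C : ℝ≥0, ∀ (ν : ℕ) (F : EuclideanSpace ℝ (Fin ν) → ℝ≥0∞)
      (u : M → EuclideanSpace ℝ (Fin ν)), Measurable F → Measurable u →
      PenalisedExtension.extEnergy d p F u univ ≤
        C * ∑ i, PenalisedExtension.extEnergy d p F u (G i) := by
  let e := Fintype.equivFin ι
  let N := Fintype.card ι
  -- the covering indexed by `ℕ`, with empty sets from `N` on
  let G' : ℕ → Set M := fun k => if h : k < N then G (e.symm ⟨k, h⟩) else ∅
  have hG'e : ∀ k : Fin N, G' k = G (e.symm k) := fun k => dif_pos k.2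
  have hG' : ∀ k, IsOpen (G' k) := by
    intro k
    by_cases h : k < N
    · simpa only [G', dif_pos h] using hG _
    · simp only [G', dif_neg h, isOpen_empty]
  obtain ⟨f, hf⟩ := SmoothPartitionOfUnity.exists_isSubordinate (𝓡 d) isClosed_univ G' hG' (by
    rw [← hcov]
    refine iUnion_subset fun i => subset_iUnion_of_subset (e i : ℕ) ?_
    rw [hG'e, e.symm_apply_apply])
  have hsum : ∀ x, ∑ k ∈ Finset.range N, f k x = 1 := by
    intro x
    rw [← f.sum_eq_one (mem_univ x)]
    refine (finsum_eq_sum_of_support_subset _ fun k hk => ?_).symm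
    by_contra hkN
    have hmem := hf k (subset_tsupport _ hk)
    rw [Finset.coe_range, mem_Iio] at hkN
    simp only [G', dif_neg hkN] at hmem
    exact hmem
  obtain ⟨C, hC⟩ := PenalisedExtension.exists_extEnergy_univ_le hp hG'
    (fun k => (f k).contMDiff) (fun k x => f.nonneg k x) hsum hf
  refine ⟨C, fun ν F u _ hu => (hC ν F u hu).trans_eq ?_⟩
  rw [Finset.sum_range]
  simp only [hG'e]
  rw [Equiv.sum_comp e.symm fun i => PenalisedExtension.extEnergy d p F u (G i)]
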